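/- Let $k\ge 1$ be an integer, let $\alpha>0$, let $\mathcal X,\mathcal Y$ be finite sets, $\mathcal X\neq\emptyset$, and let $Q(\cdot\,|\,u)$, $u\in\mathcal X^k$, be a kernel from $\mathcal X^k$ to $\mathcal Y$ (each $Q(\cdot\,|\,u)$ is a probability distribution on $\mathcal Y$). For $l\ge 1$ and a probability measure $\nu$ on $\mathcal X^l$ put $$\Gamma_l(\nu)=\frac1{|\mathcal Y|}\sum_{u^{(1)},\dots,u^{(l)}\in\mathcal X^k}\Big[\sum_{z\in\mathcal Y}\prod_{r=1}^l\big(1-Q(z|u^{(r)})\big)\Big]\prod_{i=1}^k\nu\big(u^{(1)}_i,\dots,u^{(l)}_i\big),$$ and assume Hypothesis H: for every $l\ge 1$, $\Gamma_l$ is convex on the set of probability measures on $\mathcal X^l$. For $n\ge k$ let $G$ be the random multi-edge hypergraph on $[n]$ in which the $k$-element subsets $I$ of $[n]$ have independent multiplicities $m_I\sim\mathrm{Poisson}\big(\alpha n/\binom nk\big)$; the $k$ vertices of each edge are listed in an order chosen uniformly at random, independently for different edges, and this order is part of $G$. Let $X$ be uniform on $\mathcal X^n$ and independent of $G$. Given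 $X=x$ and $G=g$, each edge $a$ of $g$ with listed vertices $(i_1,\dots,i_k)$ independently produces an output $y_a\in\mathcal Y$ with law $Q(\cdot\,|\,x_{i_1},\dots,x_{i_k})$; thus $y=(y_a)_a$ has probability $P_g(y|x)=\prod_a Q(y_a|x_{i_1},\dots,x_{i_k})$. Let $R_g(x|y)=P_g(y|x)/\sum_{x'}P_g(y|x')$ be the posterior distribution, and put $$H^{(n)}_g(X|Y)=-|\mathcal X|^{-n}\sum_{x}\sum_{y}P_g(y|x)\log_2R_g(x|y),\qquad H^{(n)}(X|Y)=\mathbb E_G\,H_G^{(n)}(X|Y).$$ Then there is a real number $C_k(\alpha,Q)$ such that $$\frac1n H^{(n)}(X|Y)\;\longrightarrow\; C_k(\alpha,Q)\qquad\text{as } n\to\infty .$$ Moreover, if $Q$ is insensitive to the order of its inputs, in the sense that for every permutation $\sigma$ of $\{1,\dots,k\}$ there is a permutation $\pi$ of $\mathcal Y$ with $Q(\pi(z)\,|\,u_{\sigma(1)},\dots,u_{\sigma(k)})=Q(z|u_1,\dots,u_k)$ for all $u,z$, then the same holds, with the same limit, if for every $n$ and every $k$-element subset $I$ of $[n]$ the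 vertices of all the $m_I$ edges on $I$ are instead listed in an arbitrary fixed (for instance the increasing) order. -/

import Mathlib

open Filter Topology MeasureTheory ProbabilityTheory
open scoped NNReal

/-- A kernel `Q(z | u)` from `𝒳^k` to `𝒴`: for each `u`, a probability distribution on `𝒴`. -/
structure Channel (k : ℕ) (𝒳 𝒴 : Type*) [Fintype 𝒴] where
  /-- `prob u z` is `Q(z | u)` -/
  prob : (Fin k → 𝒳) → 𝒴 → ℝ
  prob_nonneg : ∀ u z, 0 ≤ prob u z
  sum_prob : ∀ u, ∑ z, prob u z = 1

namespace Channel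

noncomputable section

variable {k : ℕ} {𝒳 𝒴 : Type*} [Fintype 𝒳] [Fintype 𝒴]

/-- `Γ_l(ν)`, for a (mass function of a) probability measure `ν` on `𝒳^l`. Here `u r i` is the
`i`-th entry of `u^{(r)} ∈ 𝒳^k`. -/
def Gamma (Q : Channel k 𝒳 𝒴) (l : ℕ) (ν : (Fin l → 𝒳) → ℝ) : ℝ :=
  (1 / (Fintype.card 𝒴 : ℝ)) * ∑ u : Fin l → Fin k → 𝒳,
    (∑ z : 𝒴, ∏ r : Fin l, (1 - Q.prob (u r) z)) * ∏ i : Fin k, ν (fun r => u r i)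

/-- Hypothesis H: for every `l ≥ 1` the function `Γ_l` is convex on the set of probability
measures on `𝒳^l`. -/
def HypothesisH (Q : Channel k 𝒳 𝒴) : Prop :=
  ∀ l : ℕ, 1 ≤ l → ConvexOn ℝ (stdSimplex ℝ (Fin l → 𝒳)) (Q.Gamma l)

/-- Permuting the `k` inputs of the kernel amounts to relabelling its output letters. -/
def OrderInsensitive (Q : Channel k 𝒳 𝒴) : Prop :=
  ∀ σ : Equiv.Perm (Fin k), ∃ π : Equiv.Perm 𝒴, ∀ u z, Q.prob (u ∘ σ) (π z) = Q.prob u z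

section Graph

/-! A multi-edge hypergraph on `[n]` is given by a finite type `E` of possible edges, the list
`e a` of the `k` vertices of each possible edge `a`, and the multiplicity `m a` of `a`. -/

variable {n : ℕ} {E : Type*} [Fintype E] [DecidableEq E]

/-- `P_g(y | x) = ∏_a ∏_{i ≤ m_a} Q(y_a(i) | x[a])`. -/
def likelihood (Q : Channel k 𝒳 𝒴) (e : E → Fin k → Fin n) (m : E → ℕ)
    (x : Fin n → 𝒳) (y : (a : E) → Fin (m a) → 𝒴) : ℝ :=
  ∏ a : E, ∏ i : Fin (m a), Q.prob (fun j => x (e a j)) (y a i)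

/-- The output marginal `S_g(y)`, for the uniform distribution on `𝒳^n`. -/
def outputProb (Q : Channel k 𝒳 𝒴) (e : E → Fin k → Fin n) (m : E → ℕ)
    (y : (a : E) → Fin (m a) → 𝒴) : ℝ :=
  ∑ x : Fin n → 𝒳, Q.likelihood e m x y * ((Fintype.card 𝒳 : ℝ) ^ n)⁻¹

/-- The a posteriori distribution `R_g(x | y)`. -/
def posterior (Q : Channel k 𝒳 𝒴) (e : E → Fin k → Fin n) (m : E → ℕ)
    (x : Fin n → 𝒳) (y : (a : E) → Fin (m a) → 𝒴) : ℝ :=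
  1 / Q.outputProb e m y * (Q.likelihood e m x y * ((Fintype.card 𝒳 : ℝ) ^ n)⁻¹)

/-- The conditional entropy `H_g(X | Y)` in bits (with `0 log 0 = 0`). -/
def condEntropy (Q : Channel k 𝒳 𝒴) (e : E → Fin k → Fin n) (m : E → ℕ) : ℝ :=
  -(((Fintype.card 𝒳 : ℝ) ^ n)⁻¹ * ∑ x : Fin n → 𝒳, ∑ y : (a : E) → Fin (m a) → 𝒴,
    Q.likelihood e m x y * Real.logb 2 (Q.posterior e m x y))

/-- The expectation of `H_G(X | Y)` when the multiplicities of the possible edges are independent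
Poisson variables with mean `p`. The integrand takes values in `[0, n log₂ |𝒳|]`. -/
def meanCondEntropy (Q : Channel k 𝒳 𝒴) (e : E → Fin k → Fin n) (p : ℝ≥0) : ℝ :=
  ∫ m : E → ℕ, Q.condEntropy e m ∂(Measure.pi fun _ : E => poissonMeasure p)

end Graph

/-- The set `E_k([n])` of the `k`-element subsets of the vertex set. -/
abbrev Hyperedge (k n : ℕ) : Type := {I : Finset (Fin n) // I.card = k}

/-- The Poisson parameter `α n / (n choose k)` of a hyperedge. -/
def edgeRate (k : ℕ) (α : ℝ≥0) (n : ℕ) : ℝ≥0 := α * n / (n.choose k : ℝ≥0)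

/-- `H^{(n)}(X | Y)` for the Poisson ensemble in which each `k`-subset of `[n]` is present with a
Poisson multiplicity of mean `α n / (n choose k)` and the vertices of each edge are listed in
a uniformly random order, independently of everything else. Equivalently, by splitting of Poisson
variables, the multiplicities of the `k`-tuples of distinct vertices are independent Poisson
variables with mean `α n / (n choose k) / k!`. -/
def entropy (Q : Channel k 𝒳 𝒴) (α : ℝ≥0) (n : ℕ) : ℝ :=
  Q.meanCondEntropy (fun f : Fin k ↪ Fin n => (f : Fin k → Fin n))
    (edgeRate k α n / (k.factorial : ℝ≥0))

/-- `H^{(n)}(X | Y)` for the Poisson ensemble in which each `k`-subset `I` of `[n]` is present with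
a Poisson multiplicity of mean `α n / (n choose k)` and its vertices are always listed in the
order `τ I`. -/
def entropyOfListing (Q : Channel k 𝒳 𝒴) (α : ℝ≥0) (n : ℕ)
    (τ : Hyperedge k n → Fin k → Fin n) : ℝ :=
  Q.meanCondEntropy τ (edgeRate k α n)

end

end Channel

/-!
Write `H(X | Y) = H(X) + H(Y | X) - H(Y)`. The input is uniform, and the vertices of an edge are
distinct, so that the first two terms are explicit and linear in `n` on average
(`Channel.meanCondEntropy_eq`). What has to be shown is that the mean output entropy `H(Y)`,
divided by `n`, converges.

This is an interpolation argument. By the chain rule, a further observation increases `H(Y)` by the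
mean entropy of its output under the posterior law of the input, the *predictive entropy*
(`Channel.exists_countEntropy_single_add`). Two Poisson ensembles with the same total rate can
therefore be compared by comparing, for an arbitrary law of the input, the predictive entropies of
one random edge (`Channel.meanEntropy_le`). No differentiation along the interpolation is needed:
given the number `N` of edges, the mean of a function of the configuration is a linear functional
of `P ^ N`, with `P` the linear form of the rates, and `P ^ N - P' ^ N` is divisible by `P - P'`
(`integral_pi_poisson_le`).

The comparison is used three times.

* When the vertices of each edge are independent, `H(Y)` is superadditive in `n`. Indeed
  `-t log t = w - ∑ w ^ l / (l (l - 1))` with `w = 1 - t`, the sum being over `l ≥ 2`, and the mean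
  of `∑ w ^ l` over the edges is the mean of `|𝒴| Γ_l` at the empirical distribution of `l`
  replicas of the input. The empirical distribution on `n₁ + n₂` vertices is a mixture of those on
  the two blocks, so Hypothesis H applies (`Channel.HypothesisH.tupleMean_predEntropy_le`).
  Fekete's lemma gives the limit.
* Requiring distinct vertices changes `H(Y)` by `o(n)`
  (`Channel.abs_edgeEntropy_sub_tupleEntropy_le`).
* If the kernel is insensitive to the order of its inputs, then so is the predictive entropy, and
  the way in which the vertices are listed does not matter at all
  (`Channel.OrderInsensitive.meanEntropy_listing_eq`).
-/

noncomputable section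

set_option linter.unusedSectionVars false

/-! ### Poisson expectations as exponential series of polynomials -/

section PoissonComparison

variable {σ ι κ : Type*}

/-- The linear functional on polynomials which sends the monomial with exponent vector `s` to
`f s`. -/
def monomialFunctional (f : (σ →₀ ℕ) → ℝ) : MvPolynomial σ ℝ →ₗ[ℝ] ℝ :=
  (MvPolynomial.basisMonomials σ ℝ).constr ℝ f

lemma monomialFunctional_monomial (f : (σ →₀ ℕ) → ℝ) (s : σ →₀ ℕ) (c : ℝ) :
    monomialFunctional f (MvPolynomial.monomial s c) = c * f s := by
  have h : MvPolynomial.monomial s c = c • MvPolynomial.basisMonomials σ ℝ s := by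
    rw [MvPolynomial.coe_basisMonomials, MvPolynomial.smul_monomial, smul_eq_mul, mul_one]
  rw [h, map_smul, monomialFunctional, Module.Basis.constr_basis, smul_eq_mul]

/-- The linear form `∑ a, p a * X (e a)`. Several labels `a` may carry the same variable. -/
def linearForm [Fintype ι] (e : ι → σ) (p : ι → ℝ≥0) : MvPolynomial σ ℝ :=
  ∑ a, MvPolynomial.monomial (Finsupp.single (e a) 1) (p a : ℝ)

/-- The counting vector in `σ →₀ ℕ` of a family of multiplicities `m` of labels `a`, each of which
stands for the element `e a` of `σ`. -/
def labelCount [Fintype ι] (e : ι → σ) (m : ι → ℕ) : σ →₀ ℕ :=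
  ∑ a, Finsupp.single (e a) (m a)

lemma degree_labelCount [Fintype ι] (e : ι → σ) (m : ι → ℕ) :
    (labelCount e m).degree = ∑ a, m a := by
  simp [labelCount, map_sum]

lemma linearForm_pow [Fintype ι] [DecidableEq ι] (e : ι → σ) (p : ι → ℝ≥0) (N : ℕ) :
    linearForm e p ^ N = ∑ m ∈ Finset.piAntidiag Finset.univ N,
      MvPolynomial.monomial (labelCount e m)
        ((Nat.multinomial Finset.univ m : ℝ) * ∏ a, (p a : ℝ) ^ m a) := by
  rw [linearForm, Finset.sum_pow_eq_sum_piAntidiag]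
  refine Finset.sum_congr rfl fun m _ => ?_
  simp_rw [MvPolynomial.monomial_pow]
  rw [← MvPolynomial.monomial_sum_prod, ← MvPolynomial.C_eq_coe_nat, MvPolynomial.C_mul_monomial]
  congr 2
  refine Finset.sum_congr rfl fun a _ => ?_
  rw [Finsupp.smul_single, smul_eq_mul, mul_one]

lemma integrable_eval_poisson (p : ℝ≥0) : Integrable (fun n : ℕ => (n : ℝ)) (poissonMeasure p) := by
  rw [integrable_poissonMeasure_iff]
  rw [← summable_nat_add_iff 1]
  refine ((Real.summable_pow_div_factorial (p : ℝ)).mul_left (Real.exp (-p) * p)).congr fun n => ?_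
  rw [Nat.factorial_succ]
  push_cast
  have : ‖((n : ℝ) + 1)‖ = n + 1 := by rw [Real.norm_of_nonneg]; positivity
  rw [this]
  have : (n.factorial : ℝ) ≠ 0 := by positivity
  field_simp
  ring

lemma integral_eval_poisson (p : ℝ≥0) : ∫ n : ℕ, (n : ℝ) ∂(poissonMeasure p) = p := by
  have h := hasSum_integral_poissonMeasure (integrable_eval_poisson p)
  rw [← hasSum_nat_add_iff' 1] at h
  have h2 := (hasSum_one_poissonMeasure p).mul_left (p : ℝ)
  simp only [Finset.range_one, Finset.sum_singleton, Nat.cast_zero, smul_zero, sub_zero] at h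
  rw [mul_one] at h2
  refine h.unique (Eq.subst (motive := fun g => HasSum g (p : ℝ)) (funext fun n => ?_) h2)
  rw [Nat.factorial_succ, smul_eq_mul]
  push_cast
  have : (n.factorial : ℝ) ≠ 0 := by positivity
  field_simp
  ring

lemma integrable_eval_pi_poisson [Fintype ι] (p : ι → ℝ≥0) (a : ι) :
    Integrable (fun m : ι → ℕ => (m a : ℝ)) (Measure.pi fun a => poissonMeasure (p a)) :=
  integrable_comp_eval (μ := fun a => poissonMeasure (p a)) (i := a) (integrable_eval_poisson (p a))

lemma integral_eval_pi_poisson [Fintype ι] (p : ι → ℝ≥0) (a : ι) :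
    ∫ m : ι → ℕ, (m a : ℝ) ∂(Measure.pi fun a => poissonMeasure (p a)) = p a := by
  rw [integral_comp_eval (μ := fun a => poissonMeasure (p a)) (i := a)
    (f := fun n : ℕ => (n : ℝ)) (integrable_eval_poisson (p a)).aestronglyMeasurable]
  exact integral_eval_poisson (p a)

lemma integrable_labelCount [Fintype ι] (e : ι → σ) (p : ι → ℝ≥0) {f : (σ →₀ ℕ) → ℝ} {B : ℝ}
    (hf : ∀ s, |f s| ≤ B * s.degree) :
    Integrable (fun m : ι → ℕ => f (labelCount e m))
      (Measure.pi fun a => poissonMeasure (p a)) := by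
  have h : Integrable (fun m : ι → ℕ => B * ∑ a, (m a : ℝ))
      (Measure.pi fun a => poissonMeasure (p a)) :=
    (integrable_finsetSum _ fun a _ => integrable_eval_pi_poisson p a).const_mul B
  refine h.mono' (Measurable.of_discrete.aestronglyMeasurable) (.of_forall fun m => ?_)
  have := hf (labelCount e m)
  rw [degree_labelCount] at this
  simpa using this

lemma hasSum_integral_of_countable {X : Type*} [Countable X] [MeasurableSpace X]
    [MeasurableSingletonClass X] {μ : Measure X} {f : X → ℝ} (hf : Integrable f μ) :
    HasSum (fun x => μ.real {x} * f x) (∫ x, f x ∂μ) := by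
  have h := hf
  rw [← Measure.sum_smul_dirac μ] at h
  have h' := hasSum_integral_measure h
  rw [Measure.sum_smul_dirac] at h'
  simpa [integral_smul_measure, integral_dirac, measureReal_def] using h'

/-- Summation over `ι → ℕ` by levels of the total multiplicity. -/
lemma hasSum_sum_piAntidiag [Fintype ι] [DecidableEq ι] {g : (ι → ℕ) → ℝ} {S : ℝ}
    (h : HasSum g S) :
    HasSum (fun N : ℕ => ∑ m ∈ Finset.piAntidiag Finset.univ N, g m) S := by
  rw [← (Equiv.sigmaFiberEquiv (fun m : ι → ℕ => ∑ a, m a)).hasSum_iff] at h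
  refine h.sigma fun N => ?_
  have hfin : (fun m : ι → ℕ => ∑ a, m a = N) =
      fun m => m ∈ Finset.piAntidiag (Finset.univ : Finset ι) N := by
    funext m; simp
  change HasSum (fun m : {m : ι → ℕ // (fun m : ι → ℕ => ∑ a, m a = N) m} => g m.1) _
  rw [hfin]
  exact Finset.hasSum (Finset.piAntidiag (Finset.univ : Finset ι) N) g

/-- By the multinomial theorem, the part of the expectation on which the independent Poisson
multiplicities have total `N` is given by the `N`-th power of the linear form of the rates. -/
lemma hasSum_integral_pi_poisson [Fintype ι] (e : ι → σ) (p : ι → ℝ≥0)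
    {f : (σ →₀ ℕ) → ℝ} {B : ℝ} (hf : ∀ s, |f s| ≤ B * s.degree) :
    HasSum (fun N : ℕ => Real.exp (-∑ a, (p a : ℝ)) / N.factorial *
        monomialFunctional f (linearForm e p ^ N))
      (∫ m : ι → ℕ, f (labelCount e m) ∂(Measure.pi fun a => poissonMeasure (p a))) := by
  classical
  have h := hasSum_integral_of_countable (integrable_labelCount e p hf)
  refine Eq.subst (motive := fun g => HasSum g _) (funext fun N => ?_)
    (hasSum_sum_piAntidiag h)
  rw [linearForm_pow, map_sum, Finset.mul_sum]
  refine Finset.sum_congr rfl fun m hm => ?_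
  have hmN : ∑ a, m a = N := by simpa using hm
  have hspec := Nat.multinomial_spec (Finset.univ : Finset ι) m
  rw [hmN] at hspec
  have hspec' : (∏ a, ((m a).factorial : ℝ)) * (Nat.multinomial Finset.univ m : ℝ) =
      N.factorial := by exact_mod_cast hspec
  rw [monomialFunctional_monomial, measureReal_def, Measure.pi_singleton, ENNReal.toReal_prod]
  simp_rw [← measureReal_def, poissonMeasure_real_singleton]
  rw [Finset.prod_div_distrib, Finset.prod_mul_distrib, ← Real.exp_sum, Finset.sum_neg_distrib,
    ← hspec']
  have h0 : (∏ a, ((m a).factorial : ℝ)) ≠ 0 := by positivity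
  have h1 : (Nat.multinomial Finset.univ m : ℝ) ≠ 0 := by
    exact_mod_cast (Nat.multinomial_pos _ _).ne'
  field_simp

/-! ### Comparison of Poisson ensembles with the same total rate -/

lemma coeff_mul_nonneg {P Q : MvPolynomial σ ℝ} (hP : ∀ s, 0 ≤ P.coeff s)
    (hQ : ∀ s, 0 ≤ Q.coeff s) (s : σ →₀ ℕ) : 0 ≤ (P * Q).coeff s := by
  classical
  rw [MvPolynomial.coeff_mul]
  exact Finset.sum_nonneg fun x _ => mul_nonneg (hP _) (hQ _)

lemma coeff_pow_nonneg {P : MvPolynomial σ ℝ} (hP : ∀ s, 0 ≤ P.coeff s) (n : ℕ)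
    (s : σ →₀ ℕ) : 0 ≤ (P ^ n).coeff s := by
  classical
  induction n generalizing s with
  | zero =>
    rw [pow_zero, MvPolynomial.coeff_one]
    split_ifs <;> norm_num
  | succ n ih => rw [pow_succ]; exact coeff_mul_nonneg ih hP s

lemma coeff_linearForm_nonneg [Fintype ι] (e : ι → σ) (p : ι → ℝ≥0) (s : σ →₀ ℕ) :
    0 ≤ (linearForm e p).coeff s := by
  classical
  rw [linearForm, MvPolynomial.coeff_sum]
  refine Finset.sum_nonneg fun a _ => ?_
  rw [MvPolynomial.coeff_monomial]
  split_ifs <;> simp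

lemma eval_one_linearForm [Fintype ι] (e : ι → σ) (p : ι → ℝ≥0) :
    MvPolynomial.eval 1 (linearForm e p) = ∑ a, (p a : ℝ) := by
  simp [linearForm, MvPolynomial.eval_monomial]

lemma monomialFunctional_linearForm_mul [Fintype ι] (f : (σ →₀ ℕ) → ℝ) (e : ι → σ) (p : ι → ℝ≥0)
    (s : σ →₀ ℕ) (c : ℝ) :
    monomialFunctional f (linearForm e p * MvPolynomial.monomial s c) =
      c * ∑ a, (p a : ℝ) * f (Finsupp.single (e a) 1 + s) := by
  rw [linearForm, Finset.sum_mul, map_sum, Finset.mul_sum]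
  refine Finset.sum_congr rfl fun a _ => ?_
  rw [MvPolynomial.monomial_mul, monomialFunctional_monomial]
  ring

/-- The interpolation step: exchanging one of the factors of `P ^ N` for a factor of another
linear form changes the value of the functional by the mean effect of adding a single element. -/
lemma monomialFunctional_linearForm_mul_le [Fintype ι] [Fintype κ] {f : (σ →₀ ℕ) → ℝ}
    {e : ι → σ} {p : ι → ℝ≥0} {e' : κ → σ} {p' : κ → ℝ≥0} {c : ℝ}
    (h : ∀ s, ∑ a, (p a : ℝ) * f (Finsupp.single (e a) 1 + s) ≤
      ∑ b, (p' b : ℝ) * f (Finsupp.single (e' b) 1 + s) + c)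
    {M : MvPolynomial σ ℝ} (hM : ∀ s, 0 ≤ M.coeff s) :
    monomialFunctional f (linearForm e p * M) ≤
      monomialFunctional f (linearForm e' p' * M) + c * MvPolynomial.eval 1 M := by
  rw [← MvPolynomial.support_sum_monomial_coeff M]
  simp only [Finset.mul_sum, map_sum, ← Finset.sum_add_distrib]
  refine Finset.sum_le_sum fun s _ => ?_
  rw [monomialFunctional_linearForm_mul, monomialFunctional_linearForm_mul,
    MvPolynomial.eval_monomial]
  have := mul_le_mul_of_nonneg_left (h s) (hM s)
  simpa [mul_add, mul_comm c] using this

lemma monomialFunctional_linearForm_pow_le [Fintype ι] [Fintype κ] {f : (σ →₀ ℕ) → ℝ}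
    {e : ι → σ} {p : ι → ℝ≥0} {e' : κ → σ} {p' : κ → ℝ≥0} {c : ℝ}
    (hp : ∑ a, p a = ∑ b, p' b)
    (h : ∀ s, ∑ a, (p a : ℝ) * f (Finsupp.single (e a) 1 + s) ≤
      ∑ b, (p' b : ℝ) * f (Finsupp.single (e' b) 1 + s) + c) (N : ℕ) :
    monomialFunctional f (linearForm e p ^ N) ≤
      monomialFunctional f (linearForm e' p' ^ N) + c * (N * (∑ a, (p a : ℝ)) ^ (N - 1)) := by
  set P := linearForm e p
  set P' := linearForm e' p'
  set M := ∑ i ∈ Finset.range N, P ^ i * P' ^ (N - 1 - i)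
  have hM : ∀ s, 0 ≤ M.coeff s := fun s => by
    rw [MvPolynomial.coeff_sum]
    exact Finset.sum_nonneg fun i _ => coeff_mul_nonneg
      (coeff_pow_nonneg (coeff_linearForm_nonneg e p) _)
      (coeff_pow_nonneg (coeff_linearForm_nonneg e' p') _) s
  have hp' : ∑ b, (p' b : ℝ) = ∑ a, (p a : ℝ) := by exact_mod_cast hp.symm
  have heval : MvPolynomial.eval 1 M = N * (∑ a, (p a : ℝ)) ^ (N - 1) := by
    rw [map_sum, Finset.sum_congr rfl (g := fun _ => (∑ a, (p a : ℝ)) ^ (N - 1))]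
    · simp
    · intro i hi
      rw [map_mul, map_pow, map_pow, eval_one_linearForm, eval_one_linearForm, hp', ← pow_add]
      congr 1
      have := Finset.mem_range.mp hi
      omega
  -- `P ^ N - P' ^ N = (P - P') * M`, written without subtraction.
  have hgeom : P ^ N + P' * M = P' ^ N + P * M := by
    have := (Commute.all P P').geom_sum₂_mul N
    linear_combination -this
  have hle := monomialFunctional_linearForm_mul_le h hM
  have := congrArg (monomialFunctional f) hgeom
  rw [map_add, map_add] at this
  rw [heval] at hle
  linarith

/-- Two Poisson ensembles of elements of `σ` with the same total rate are compared through the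
effect of adding a single element: if, from any configuration `s`, a random element of the first
ensemble increases `f` by at most `c` more than one of the second, then the mean of `f` in the
first ensemble exceeds that in the second by at most `c`. -/
theorem integral_pi_poisson_le [Fintype ι] [Fintype κ] {f : (σ →₀ ℕ) → ℝ} {B : ℝ}
    (hf : ∀ s, |f s| ≤ B * s.degree)
    {e : ι → σ} {p : ι → ℝ≥0} {e' : κ → σ} {p' : κ → ℝ≥0} {c : ℝ}
    (hp : ∑ a, p a = ∑ b, p' b)
    (h : ∀ s, ∑ a, (p a : ℝ) * f (Finsupp.single (e a) 1 + s) ≤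
      ∑ b, (p' b : ℝ) * f (Finsupp.single (e' b) 1 + s) + c) :
    ∫ m : ι → ℕ, f (labelCount e m) ∂(Measure.pi fun a => poissonMeasure (p a)) ≤
      ∫ m : κ → ℕ, f (labelCount e' m) ∂(Measure.pi fun b => poissonMeasure (p' b)) + c := by
  have h1 := hasSum_integral_pi_poisson e p hf
  have h2 := hasSum_integral_pi_poisson e' p' hf
  have hp' : ∑ b, (p' b : ℝ) = ∑ a, (p a : ℝ) := by exact_mod_cast hp.symm
  rw [hp'] at h2
  set Λ := ∑ a, (p a : ℝ)
  -- The errors `c * N * Λ ^ (N - 1)` sum to `c` under the Poisson weights.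
  have h3 : HasSum (fun N : ℕ => Real.exp (-Λ) / N.factorial * (c * (N * Λ ^ (N - 1)))) c := by
    rw [← hasSum_nat_add_iff' 1]
    have h4 := (hasSum_one_poissonMeasure (∑ a, p a)).mul_left c
    have hΛ : ((∑ a, p a : ℝ≥0) : ℝ) = Λ := by push_cast; rfl
    rw [hΛ, mul_one] at h4
    simp only [Finset.range_one, Finset.sum_singleton, Nat.cast_zero, zero_mul, mul_zero, sub_zero]
    refine Eq.subst (motive := fun g => HasSum g c) (funext fun n => ?_) h4
    rw [Nat.factorial_succ, Nat.add_sub_cancel]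
    push_cast
    have : (n.factorial : ℝ) ≠ 0 := by positivity
    field_simp
  refine hasSum_le (fun N => ?_) h1 (h2.add h3)
  rw [← mul_add]
  exact mul_le_mul_of_nonneg_left (monomialFunctional_linearForm_pow_le hp h N) (by positivity)

end PoissonComparison

/-! ### Entropy of finite distributions -/

section FiniteEntropy

variable {A : Type*} [Fintype A]

lemma sum_negMulLog_nonneg {p : A → ℝ} (h0 : ∀ a, 0 ≤ p a) (h1 : ∑ a, p a = 1) :
    0 ≤ ∑ a, Real.negMulLog (p a) :=
  Finset.sum_nonneg fun a _ => Real.negMulLog_nonneg (h0 a)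
    (h1 ▸ Finset.single_le_sum (fun b _ => h0 b) (Finset.mem_univ a))

lemma sum_negMulLog_le_log_card {p : A → ℝ} (h0 : ∀ a, 0 ≤ p a) (h1 : ∑ a, p a = 1) :
    ∑ a, Real.negMulLog (p a) ≤ Real.log (Fintype.card A) := by
  have hA : 0 < (Fintype.card A : ℝ) := by
    rcases isEmpty_or_nonempty A with h | h
    · simp at h1
    · exact_mod_cast Fintype.card_pos
  have h := Real.concaveOn_negMulLog.le_map_sum (t := Finset.univ)
    (w := fun _ : A => (Fintype.card A : ℝ)⁻¹) (p := p) (fun _ _ => by positivity)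
    (by simp [hA.ne']) (fun a _ => h0 a)
  simp only [smul_eq_mul, ← Finset.mul_sum, h1, mul_one] at h
  rw [Real.negMulLog, Real.log_inv] at h
  have := mul_le_mul_of_nonneg_left h hA.le
  rw [← mul_assoc, mul_inv_cancel₀ hA.ne', one_mul] at this
  refine this.trans_eq ?_
  field_simp

lemma negMulLog_prod {J : Type*} [DecidableEq J] (s : Finset J) (f : J → ℝ) :
    Real.negMulLog (∏ j ∈ s, f j) =
      ∑ j ∈ s, Real.negMulLog (f j) * ∏ i ∈ s.erase j, f i := by
  induction s using Finset.induction_on with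
  | empty => simp
  | insert a s ha ih =>
    rw [Finset.prod_insert ha, Real.negMulLog_mul, ih, Finset.sum_insert ha,
      Finset.erase_insert ha, Finset.mul_sum, mul_comm (∏ j ∈ s, f j)]
    congr 1
    refine Finset.sum_congr rfl fun j hj => ?_
    have hja : j ≠ a := fun h => ha (h ▸ hj)
    rw [Finset.erase_insert_of_ne hja.symm, Finset.prod_insert (by simp [ha])]
    ring

/-- The entropy of a product distribution is the sum of the entropies of its factors. -/
lemma sum_negMulLog_prod {J : Type*} [Fintype J] [DecidableEq J] {f : J → A → ℝ}
    (hf : ∀ j, ∑ z, f j z = 1) :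
    ∑ y : J → A, Real.negMulLog (∏ j, f j (y j)) = ∑ j, ∑ z, Real.negMulLog (f j z) := by
  simp_rw [negMulLog_prod]
  rw [Finset.sum_comm]
  refine Finset.sum_congr rfl fun j _ => ?_
  have h : ∀ y : J → A, Real.negMulLog (f j (y j)) * ∏ i ∈ Finset.univ.erase j, f i (y i) =
      ∏ i, (if i = j then Real.negMulLog (f i (y i)) else f i (y i)) := fun y => by
    rw [← Finset.mul_prod_erase _ _ (Finset.mem_univ j), if_pos rfl]
    congr 1
    exact Finset.prod_congr rfl fun i hi => (if_neg (Finset.ne_of_mem_erase hi)).symm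
  simp_rw [h]
  have h2 := Finset.prod_univ_sum (fun _ : J => (Finset.univ : Finset A))
    (fun i z => if i = j then Real.negMulLog (f i z) else f i z)
  rw [Fintype.piFinset_univ] at h2
  rw [← h2, ← Finset.mul_prod_erase _ _ (Finset.mem_univ j), Finset.prod_eq_one, mul_one]
  · simp
  · intro i hi
    simp [Finset.ne_of_mem_erase hi, hf]

end FiniteEntropy

namespace Channel

variable {k : ℕ} {𝒳 𝒴 : Type*} [Fintype 𝒳] [Fintype 𝒴]
variable {V V₁ V₂ : Type*} [Fintype V] [DecidableEq V] [Fintype V₁] [DecidableEq V₁]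
  [Fintype V₂] [DecidableEq V₂]
variable {J J' J₁ J₂ : Type*} [Fintype J] [DecidableEq J] [Fintype J'] [DecidableEq J']
  [Fintype J₁] [DecidableEq J₁] [Fintype J₂] [DecidableEq J₂]

/-! ### The output of a finite family of observations -/

/-- The joint law of an input `x`, uniform on `V → 𝒳`, and of the outputs `y` of observations
indexed by `J`, of which the `j`-th one reads the vertices `ε j 0, …, ε j (k - 1)`. -/
def jointProb (Q : Channel k 𝒳 𝒴) (ε : J → Fin k → V) (x : V → 𝒳) (y : J → 𝒴) : ℝ :=
  (∏ j, Q.prob (fun i => x (ε j i)) (y j)) * ((Fintype.card 𝒳 : ℝ) ^ Fintype.card V)⁻¹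

/-- The law of the outputs `y`. -/
def outProb (Q : Channel k 𝒳 𝒴) (ε : J → Fin k → V) (y : J → 𝒴) : ℝ :=
  ∑ x, Q.jointProb ε x y

/-- The entropy of the outputs, in nats. -/
def outEntropy (Q : Channel k 𝒳 𝒴) (ε : J → Fin k → V) : ℝ :=
  ∑ y, Real.negMulLog (Q.outProb ε y)

/-- The law of a further output, of an observation of the vertices `t`, when the input has
law `R`. -/
def predProb (Q : Channel k 𝒳 𝒴) (R : (V → 𝒳) → ℝ) (t : Fin k → V) (z : 𝒴) : ℝ :=
  ∑ x, R x * Q.prob (fun i => x (t i)) z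

/-- The entropy of a further output, of an observation of the vertices `t`, when the input has
law `R`. -/
def predEntropy (Q : Channel k 𝒳 𝒴) (R : (V → 𝒳) → ℝ) (t : Fin k → V) : ℝ :=
  ∑ z, Real.negMulLog (Q.predProb R t z)

lemma jointProb_nonneg (Q : Channel k 𝒳 𝒴) (ε : J → Fin k → V) (x : V → 𝒳) (y : J → 𝒴) :
    0 ≤ Q.jointProb ε x y :=
  mul_nonneg (Finset.prod_nonneg fun _ _ => Q.prob_nonneg _ _) (by positivity)

lemma outProb_nonneg (Q : Channel k 𝒳 𝒴) (ε : J → Fin k → V) (y : J → 𝒴) :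
    0 ≤ Q.outProb ε y :=
  Finset.sum_nonneg fun _ _ => Q.jointProb_nonneg ε _ y

lemma sum_prod_prob (Q : Channel k 𝒳 𝒴) (u : J → Fin k → 𝒳) :
    ∑ y : J → 𝒴, ∏ j, Q.prob (u j) (y j) = 1 := by
  have h := Finset.prod_univ_sum (fun _ : J => (Finset.univ : Finset 𝒴))
    (fun j z => Q.prob (u j) z)
  rw [Fintype.piFinset_univ] at h
  rw [← h]
  simp [Q.sum_prob]

lemma sum_outProb [Nonempty 𝒳] (Q : Channel k 𝒳 𝒴) (ε : J → Fin k → V) :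
    ∑ y, Q.outProb ε y = 1 := by
  simp_rw [outProb, jointProb]
  rw [Finset.sum_comm]
  simp_rw [← Finset.sum_mul, sum_prod_prob]
  have : (Fintype.card 𝒳 : ℝ) ≠ 0 := by exact_mod_cast Fintype.card_ne_zero
  simp [this]

lemma outEntropy_nonneg [Nonempty 𝒳] (Q : Channel k 𝒳 𝒴) (ε : J → Fin k → V) :
    0 ≤ Q.outEntropy ε :=
  sum_negMulLog_nonneg (Q.outProb_nonneg ε) (Q.sum_outProb ε)

lemma outEntropy_le [Nonempty 𝒳] (Q : Channel k 𝒳 𝒴) (ε : J → Fin k → V) :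
    Q.outEntropy ε ≤ Fintype.card J * Real.log (Fintype.card 𝒴) := by
  refine (sum_negMulLog_le_log_card (Q.outProb_nonneg ε) (Q.sum_outProb ε)).trans_eq ?_
  rw [Fintype.card_fun, Nat.cast_pow, Real.log_pow]

lemma predProb_nonneg (Q : Channel k 𝒳 𝒴) {R : (V → 𝒳) → ℝ} (hR : ∀ x, 0 ≤ R x)
    (t : Fin k → V) (z : 𝒴) : 0 ≤ Q.predProb R t z :=
  Finset.sum_nonneg fun x _ => mul_nonneg (hR x) (Q.prob_nonneg _ _)

lemma sum_predProb (Q : Channel k 𝒳 𝒴) (R : (V → 𝒳) → ℝ) (t : Fin k → V) :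
    ∑ z, Q.predProb R t z = ∑ x, R x := by
  simp_rw [predProb]
  rw [Finset.sum_comm]
  simp_rw [← Finset.mul_sum, Q.sum_prob, mul_one]

lemma predEntropy_nonneg (Q : Channel k 𝒳 𝒴) {R : (V → 𝒳) → ℝ} (hR : R ∈ stdSimplex ℝ (V → 𝒳))
    (t : Fin k → V) : 0 ≤ Q.predEntropy R t :=
  sum_negMulLog_nonneg (Q.predProb_nonneg hR.1 t) ((Q.sum_predProb R t).trans hR.2)

lemma predEntropy_le (Q : Channel k 𝒳 𝒴) {R : (V → 𝒳) → ℝ} (hR : R ∈ stdSimplex ℝ (V → 𝒳))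
    (t : Fin k → V) : Q.predEntropy R t ≤ Real.log (Fintype.card 𝒴) :=
  sum_negMulLog_le_log_card (Q.predProb_nonneg hR.1 t) ((Q.sum_predProb R t).trans hR.2)

lemma OrderInsensitive.predEntropy_comp {Q : Channel k 𝒳 𝒴} (hQ : Q.OrderInsensitive)
    (R : (V → 𝒳) → ℝ) (t : Fin k → V) (τ : Equiv.Perm (Fin k)) :
    Q.predEntropy R (t ∘ τ) = Q.predEntropy R t := by
  obtain ⟨π, hπ⟩ := hQ τ
  rw [predEntropy, predEntropy, ← Equiv.sum_comp π]
  refine Finset.sum_congr rfl fun z _ => ?_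
  congr 1
  exact Finset.sum_congr rfl fun x _ => by rw [← hπ (fun i => x (t i)) z]; rfl

lemma outEntropy_comp_equiv (Q : Channel k 𝒳 𝒴) (φ : J ≃ J') (ε : J' → Fin k → V) :
    Q.outEntropy (ε ∘ φ) = Q.outEntropy ε := by
  rw [outEntropy, outEntropy, ← Equiv.sum_comp (Equiv.arrowCongr φ (Equiv.refl 𝒴))]
  refine Finset.sum_congr rfl fun y _ => ?_
  congr 1
  refine Finset.sum_congr rfl fun x _ => ?_
  rw [jointProb, jointProb, ← Equiv.prod_comp φ]
  simp [Equiv.arrowCongr]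

/-- The entropy of the outputs depends only on how often each tuple of vertices is observed. -/
lemma outEntropy_eq_of_card_fiber (Q : Channel k 𝒳 𝒴) {ε : J → Fin k → V}
    {ε' : J' → Fin k → V}
    (h : ∀ t, Fintype.card {j // ε j = t} = Fintype.card {j // ε' j = t}) :
    Q.outEntropy ε = Q.outEntropy ε' := by
  have φ := fun t => Fintype.equivOfCardEq (h t)
  rw [← Q.outEntropy_comp_equiv (Equiv.ofFiberEquiv φ) ε']
  congr 1
  funext j
  exact (Equiv.ofFiberEquiv_map φ j).symm

/-- **Chain rule.** A further observation of the vertices `t` increases the entropy of the outputs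
by the mean, over the outputs `y`, of the entropy of the further output under the posterior
distribution of the input. -/
lemma exists_outEntropy_option [Nonempty 𝒳] (Q : Channel k 𝒳 𝒴) (ε : J → Fin k → V) :
    ∃ R : (J → 𝒴) → (V → 𝒳) → ℝ,
      (∀ y, Q.outProb ε y ≠ 0 → R y ∈ stdSimplex ℝ (V → 𝒳)) ∧
      ∀ t, Q.outEntropy (fun o : Option J => o.elim t ε) =
        Q.outEntropy ε + ∑ y, Q.outProb ε y * Q.predEntropy (R y) t := by
  refine ⟨fun y x => Q.jointProb ε x y / Q.outProb ε y, fun y hy => ⟨fun x => ?_, ?_⟩, fun t => ?_⟩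
  · exact div_nonneg (Q.jointProb_nonneg ε x y) (Q.outProb_nonneg ε y)
  · rw [← Finset.sum_div]
    exact div_self hy
  · have hsplit : ∀ z y, Q.outProb (fun o : Option J => o.elim t ε)
        ((Equiv.piOptionEquivProd (β := fun _ : Option J => 𝒴)).symm (z, y)) =
        Q.outProb ε y * Q.predProb (fun x => Q.jointProb ε x y / Q.outProb ε y) t z := by
      intro z y
      have h1 : Q.outProb (fun o : Option J => o.elim t ε)
          ((Equiv.piOptionEquivProd (β := fun _ : Option J => 𝒴)).symm (z, y)) =
          ∑ x, Q.jointProb ε x y * Q.prob (fun i => x (t i)) z := by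
        refine Finset.sum_congr rfl fun x _ => ?_
        rw [jointProb, jointProb, Fintype.prod_option]
        simp only [Option.elim, Equiv.piOptionEquivProd]
        simp
        ring
      rw [h1, predProb, Finset.mul_sum]
      refine Finset.sum_congr rfl fun x _ => ?_
      rcases eq_or_ne (Q.outProb ε y) 0 with h0 | h0
      · have := (Finset.sum_eq_zero_iff_of_nonneg
          (fun x _ => Q.jointProb_nonneg ε x y)).mp h0 x (Finset.mem_univ x)
        rw [this, h0]
        simp
      · field_simp
    rw [outEntropy, ← Equiv.sum_comp (Equiv.piOptionEquivProd (β := fun _ : Option J => 𝒴)).symm,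
      Fintype.sum_prod_type, Finset.sum_comm, outEntropy, ← Finset.sum_add_distrib]
    refine Finset.sum_congr rfl fun y _ => ?_
    simp_rw [hsplit, Real.negMulLog_mul]
    rw [Finset.sum_add_distrib, ← Finset.sum_mul, ← Finset.mul_sum, sum_predProb]
    rcases eq_or_ne (Q.outProb ε y) 0 with h0 | h0
    · rw [h0]
      simp
    · rw [← Finset.sum_div, ← outProb, div_self h0, one_mul]
      rfl

/-- Observations of disjoint sets of vertices have independent outputs. -/
lemma outProb_sum (Q : Channel k 𝒳 𝒴) (φ : V₁ ⊕ V₂ ≃ V) (ε₁ : J₁ → Fin k → V₁)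
    (ε₂ : J₂ → Fin k → V₂) (y₁ : J₁ → 𝒴) (y₂ : J₂ → 𝒴) :
    Q.outProb (Sum.elim (fun j i => φ (.inl (ε₁ j i))) (fun j i => φ (.inr (ε₂ j i))))
      (Sum.elim y₁ y₂) = Q.outProb ε₁ y₁ * Q.outProb ε₂ y₂ := by
  rw [outProb, outProb, outProb, Finset.sum_mul_sum, ← Fintype.sum_prod_type',
    ← Equiv.sum_comp ((Equiv.sumArrowEquivProdArrow V₁ V₂ 𝒳).symm.trans
      (Equiv.arrowCongr φ (Equiv.refl 𝒳)))]
  refine Finset.sum_congr rfl fun x _ => ?_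
  have hV : Fintype.card V = Fintype.card V₁ + Fintype.card V₂ := by
    rw [← Fintype.card_sum, Fintype.card_congr φ]
  simp only [jointProb, Fintype.prod_sum_type, hV, pow_add, mul_inv]
  simp [Equiv.arrowCongr, Equiv.sumArrowEquivProdArrow]
  ring

lemma outEntropy_sum [Nonempty 𝒳] (Q : Channel k 𝒳 𝒴) (φ : V₁ ⊕ V₂ ≃ V) (ε₁ : J₁ → Fin k → V₁)
    (ε₂ : J₂ → Fin k → V₂) :
    Q.outEntropy (Sum.elim (fun j i => φ (.inl (ε₁ j i))) (fun j i => φ (.inr (ε₂ j i)))) =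
      Q.outEntropy ε₁ + Q.outEntropy ε₂ := by
  rw [outEntropy, ← Equiv.sum_comp (Equiv.sumArrowEquivProdArrow J₁ J₂ 𝒴).symm,
    Fintype.sum_prod_type]
  have h : ∀ y₁ y₂, Real.negMulLog (Q.outProb
      (Sum.elim (fun j i => φ (.inl (ε₁ j i))) (fun j i => φ (.inr (ε₂ j i))))
      ((Equiv.sumArrowEquivProdArrow J₁ J₂ 𝒴).symm (y₁, y₂))) =
      Q.outProb ε₂ y₂ * Real.negMulLog (Q.outProb ε₁ y₁) +
        Q.outProb ε₁ y₁ * Real.negMulLog (Q.outProb ε₂ y₂) := fun y₁ y₂ => by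
    rw [← Real.negMulLog_mul, ← Q.outProb_sum φ]
    rfl
  simp_rw [h, Finset.sum_add_distrib, ← Finset.mul_sum, ← Finset.sum_mul, sum_outProb, one_mul]
  rfl

/-! ### The output entropy as a function of the multiplicities -/

/-- The entropy of the outputs when each tuple `t` of vertices is observed `s t` times. -/
def countEntropy (Q : Channel k 𝒳 𝒴) (s : (Fin k → V) →₀ ℕ) : ℝ :=
  Q.outEntropy (fun j : Σ t, Fin (s t) => j.1)

lemma card_fiber_sigma {ι T : Type*} [Fintype ι] [DecidableEq T] (e : ι → T) (m : ι → ℕ)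
    (t : T) : Fintype.card {j : Σ a, Fin (m a) // e j.1 = t} = labelCount e m t := by
  rw [Fintype.card_subtype, Finset.card_filter, Fintype.sum_sigma, labelCount,
    Finsupp.finsetSum_apply]
  refine Finset.sum_congr rfl fun a _ => ?_
  rw [Finsupp.single_apply]
  split_ifs <;> simp

lemma labelCount_id {T : Type*} [Fintype T] (s : T →₀ ℕ) : labelCount (fun t => t) s = s := by
  classical
  ext t
  simp [labelCount]

lemma countEntropy_labelCount {ι : Type*} [Fintype ι] [DecidableEq ι] (Q : Channel k 𝒳 𝒴)
    (e : ι → Fin k → V) (m : ι → ℕ) :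
    Q.countEntropy (labelCount e m) = Q.outEntropy (fun j : Σ a, Fin (m a) => e j.1) := by
  refine Q.outEntropy_eq_of_card_fiber fun t => ?_
  rw [card_fiber_sigma e m t]
  have := card_fiber_sigma (fun t : Fin k → V => t) (labelCount e m) t
  rwa [labelCount_id] at this

lemma exists_countEntropy_single_add [Nonempty 𝒳] (Q : Channel k 𝒳 𝒴)
    (s : (Fin k → V) →₀ ℕ) :
    ∃ (w : ((Σ t, Fin (s t)) → 𝒴) → ℝ) (R : ((Σ t, Fin (s t)) → 𝒴) → (V → 𝒳) → ℝ),
      (∀ y, 0 ≤ w y) ∧ ∑ y, w y = 1 ∧ (∀ y, w y ≠ 0 → R y ∈ stdSimplex ℝ (V → 𝒳)) ∧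
      ∀ t, Q.countEntropy (Finsupp.single t 1 + s) =
        Q.countEntropy s + ∑ y, w y * Q.predEntropy (R y) t := by
  obtain ⟨R, hR, h⟩ := Q.exists_outEntropy_option (fun j : Σ t, Fin (s t) => j.1)
  refine ⟨_, R, Q.outProb_nonneg _, Q.sum_outProb _, hR, fun t => ?_⟩
  rw [countEntropy, countEntropy, ← h t]
  refine Q.outEntropy_eq_of_card_fiber fun t' => ?_
  have h1 := card_fiber_sigma (fun t : Fin k → V => t) (⇑(Finsupp.single t 1 + s : (Fin k → V) →₀ ℕ)) t'
  have h2 := card_fiber_sigma (fun t : Fin k → V => t) (⇑s) t'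
  rw [labelCount_id] at h1 h2
  rw [h1, Fintype.card_subtype, Finset.card_filter, Fintype.sum_option]
  rw [Fintype.card_subtype, Finset.card_filter] at h2
  rw [Finsupp.add_apply, Finsupp.single_apply, ← h2]
  congr!

lemma abs_countEntropy_le [Nonempty 𝒳] (Q : Channel k 𝒳 𝒴) (s : (Fin k → V) →₀ ℕ) :
    |Q.countEntropy s| ≤ Real.log (Fintype.card 𝒴) * s.degree := by
  rw [countEntropy, abs_of_nonneg (Q.outEntropy_nonneg _)]
  refine (Q.outEntropy_le _).trans_eq ?_
  rw [mul_comm, Fintype.card_sigma]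
  simp [Finsupp.degree_eq_sum]

/-! ### The mean output entropy of Poisson ensembles -/

section Mean

variable {ι κ : Type*} [Fintype ι] [DecidableEq ι] [Fintype κ] [DecidableEq κ]

/-- The mean entropy of the outputs, in nats, when the multiplicities of the labels `a` are
independent Poisson variables with means `p a`, and each copy of the label `a` stands for an
observation of the vertices `e a`. -/
def meanEntropy (Q : Channel k 𝒳 𝒴) (e : ι → Fin k → V) (p : ι → ℝ≥0) : ℝ :=
  ∫ m : ι → ℕ, Q.outEntropy (fun j : Σ a, Fin (m a) => e j.1)
    ∂(Measure.pi fun a => poissonMeasure (p a))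

lemma integrable_outEntropy [Nonempty 𝒳] (Q : Channel k 𝒳 𝒴) (e : ι → Fin k → V)
    (p : ι → ℝ≥0) :
    Integrable (fun m : ι → ℕ => Q.outEntropy (fun j : Σ a, Fin (m a) => e j.1))
      (Measure.pi fun a => poissonMeasure (p a)) := by
  simp_rw [← countEntropy_labelCount]
  exact integrable_labelCount e p Q.abs_countEntropy_le

lemma meanEntropy_le_log_mul [Nonempty 𝒳] (Q : Channel k 𝒳 𝒴) (e : ι → Fin k → V)
    (p : ι → ℝ≥0) : Q.meanEntropy e p ≤ (∑ a, (p a : ℝ)) * Real.log (Fintype.card 𝒴) := by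
  have hi : ∀ a ∈ Finset.univ, Integrable (fun m : ι → ℕ => (m a : ℝ))
      (Measure.pi fun a => poissonMeasure (p a)) := fun a _ => integrable_eval_pi_poisson p a
  have h : ∫ m : ι → ℕ, (∑ a, (m a : ℝ)) * Real.log (Fintype.card 𝒴)
      ∂(Measure.pi fun a => poissonMeasure (p a)) =
      (∑ a, (p a : ℝ)) * Real.log (Fintype.card 𝒴) := by
    rw [integral_mul_const, integral_finsetSum _ hi]
    simp_rw [integral_eval_pi_poisson]
  rw [← h]
  refine integral_mono (Q.integrable_outEntropy e p)
    ((integrable_finsetSum _ hi).mul_const _) fun m => ?_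
  refine (Q.outEntropy_le _).trans_eq ?_
  simp

lemma sum_mul_add_sum {A : Type*} [Fintype A] (q : ι → ℝ) (C : ℝ) (w : A → ℝ)
    (F : A → ι → ℝ) :
    ∑ a, q a * (C + ∑ y, w y * F y a) =
      (∑ a, q a) * C + ∑ y, w y * ∑ a, q a * F y a := by
  simp_rw [mul_add, Finset.sum_add_distrib, ← Finset.sum_mul, Finset.mul_sum]
  rw [Finset.sum_comm]
  congr 1
  exact Finset.sum_congr rfl fun y _ => Finset.sum_congr rfl fun a _ => by ring

/-- Comparison of two Poisson ensembles with the same total rate: it suffices to compare the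
predictive entropies of a single random observation, whatever the law `R` of the input. -/
theorem meanEntropy_le [Nonempty 𝒳] (Q : Channel k 𝒳 𝒴) {e : ι → Fin k → V} {p : ι → ℝ≥0}
    {e' : κ → Fin k → V} {p' : κ → ℝ≥0} {c : ℝ} (hp : ∑ a, p a = ∑ b, p' b)
    (h : ∀ R ∈ stdSimplex ℝ (V → 𝒳), ∑ a, (p a : ℝ) * Q.predEntropy R (e a) ≤
      ∑ b, (p' b : ℝ) * Q.predEntropy R (e' b) + c) :
    Q.meanEntropy e p ≤ Q.meanEntropy e' p' + c := by
  have hmean : ∀ (s : (Fin k → V) →₀ ℕ), ∑ a, (p a : ℝ) *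
      Q.countEntropy (Finsupp.single (e a) 1 + s) ≤
      ∑ b, (p' b : ℝ) * Q.countEntropy (Finsupp.single (e' b) 1 + s) + c := by
    intro s
    obtain ⟨w, R, hw, hw1, hR, hs⟩ := Q.exists_countEntropy_single_add s
    have hp' : ∑ a, (p a : ℝ) = ∑ b, (p' b : ℝ) := by exact_mod_cast hp
    simp_rw [hs, sum_mul_add_sum, hp']
    rw [add_assoc]
    refine add_le_add_right ?_ _
    calc ∑ y, w y * ∑ a, (p a : ℝ) * Q.predEntropy (R y) (e a)
        ≤ ∑ y, w y * (∑ b, (p' b : ℝ) * Q.predEntropy (R y) (e' b) + c) := by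
          refine Finset.sum_le_sum fun y _ => ?_
          rcases eq_or_ne (w y) 0 with h0 | h0
          · simp [h0]
          · exact mul_le_mul_of_nonneg_left (h _ (hR y h0)) (hw y)
      _ = _ := by simp_rw [mul_add, Finset.sum_add_distrib, ← Finset.sum_mul, hw1, one_mul]
  simp only [meanEntropy, ← countEntropy_labelCount]
  exact integral_pi_poisson_le Q.abs_countEntropy_le hp hmean

/-- Ensembles on disjoint sets of vertices contribute additively. -/
lemma meanEntropy_sum [Nonempty 𝒳] (Q : Channel k 𝒳 𝒴) (φ : V₁ ⊕ V₂ ≃ V) (e₁ : ι → Fin k → V₁)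
    (e₂ : κ → Fin k → V₂) (p₁ : ι → ℝ≥0) (p₂ : κ → ℝ≥0) :
    Q.meanEntropy (Sum.elim (fun a i => φ (.inl (e₁ a i))) (fun b i => φ (.inr (e₂ b i))))
      (Sum.elim p₁ p₂) = Q.meanEntropy e₁ p₁ + Q.meanEntropy e₂ p₂ := by
  have hsplit : ∀ m : ι ⊕ κ → ℕ, Q.outEntropy (fun j : Σ c, Fin (m c) =>
      (Sum.elim (fun a i => φ (.inl (e₁ a i))) (fun b i => φ (.inr (e₂ b i))) :
        ι ⊕ κ → Fin k → V) j.1) =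
      Q.outEntropy (fun j : Σ a, Fin (m (.inl a)) => e₁ j.1) +
        Q.outEntropy (fun j : Σ b, Fin (m (.inr b)) => e₂ j.1) := by
    intro m
    rw [← Q.outEntropy_sum φ]
    rw [← Q.outEntropy_comp_equiv (Equiv.sumSigmaDistrib (fun c => Fin (m c))).symm]
    congr 1
    funext j
    rcases j with j | j <;> rfl
  have hmp := measurePreserving_sumPiEquivProdPi
    (fun c : ι ⊕ κ => poissonMeasure (Sum.elim p₁ p₂ c))
  have h1 := (measurePreserving_fst (μ := Measure.pi fun a => poissonMeasure (p₁ a))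
    (ν := Measure.pi fun b => poissonMeasure (p₂ b))).comp hmp
  have h2 := (measurePreserving_snd (μ := Measure.pi fun a => poissonMeasure (p₁ a))
    (ν := Measure.pi fun b => poissonMeasure (p₂ b))).comp hmp
  have i1 := Q.integrable_outEntropy e₁ p₁
  have i2 := Q.integrable_outEntropy e₂ p₂
  have j1 := (h1.integrable_comp i1.aestronglyMeasurable).mpr i1
  have j2 := (h2.integrable_comp i2.aestronglyMeasurable).mpr i2
  simp only [meanEntropy, hsplit]
  refine (integral_add j1 j2).trans ?_
  congr 1
  · rw [← h1.map_eq, integral_map h1.measurable.aemeasurable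
      Measurable.of_discrete.aestronglyMeasurable]
    rfl
  · rw [← h2.map_eq, integral_map h2.measurable.aemeasurable
      Measurable.of_discrete.aestronglyMeasurable]
    rfl

end Mean

end Channel

/-! ### The entropy function as a power series -/

lemma hasSum_one_div_mul_succ :
    HasSum (fun l : ℕ => 1 / (((l : ℝ) + 1) * (l + 2))) 1 := by
  rw [hasSum_iff_tendsto_nat_of_nonneg (fun l => by positivity)]
  have h : ∀ n : ℕ, ∑ l ∈ Finset.range n, 1 / (((l : ℝ) + 1) * (l + 2)) = 1 - 1 / ((n : ℝ) + 1) := by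
    intro n
    induction n with
    | zero => simp
    | succ n ih =>
      rw [Finset.sum_range_succ, ih]
      push_cast
      have h1 : (n : ℝ) + 1 ≠ 0 := by positivity
      have h2 : (n : ℝ) + 2 ≠ 0 := by positivity
      have h3 : (n : ℝ) + 1 + 1 ≠ 0 := by positivity
      field_simp
      ring
  simp_rw [h]
  simpa using (tendsto_one_div_add_atTop_nhds_zero_nat (𝕜 := ℝ)).const_sub 1

/-- In terms of `w = 1 - t`, one has `-t log t = w - ∑ w ^ l / (l (l - 1))`, the sum being over
`l ≥ 2`. All coefficients but the first are negative, which is why convexity of the replica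
functionals gives superadditivity of the entropy. -/
lemma hasSum_one_sub_sub_negMulLog {t : ℝ} (h0 : 0 ≤ t) (h1 : t ≤ 1) :
    HasSum (fun l : ℕ => (1 - t) ^ (l + 2) / (((l : ℝ) + 1) * (l + 2)))
      ((1 - t) - Real.negMulLog t) := by
  rcases h0.eq_or_lt with rfl | h0
  · simpa using hasSum_one_div_mul_succ
  have hw : |1 - t| < 1 := by rw [abs_lt]; constructor <;> linarith
  have hs := Real.hasSum_pow_div_log_of_abs_lt_one hw
  rw [sub_sub_cancel] at hs
  -- `w - (1 - w) (-log (1 - w))` is assembled from the series of `-log (1 - w)`.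
  have hs1 := (hasSum_nat_add_iff' 1).mpr hs
  have hs2 := (hs.mul_left (1 - t)).sub hs1
  have hval : (1 - t) * -Real.log t - (-Real.log t - ∑ i ∈ Finset.range 1,
      (1 - t) ^ (i + 1) / ((i : ℝ) + 1)) = (1 - t) - Real.negMulLog t := by
    simp [Real.negMulLog]
    ring
  rw [hval] at hs2
  refine Eq.subst (motive := fun g => HasSum g _) (funext fun l => ?_) hs2
  push_cast
  have h2 : (l : ℝ) + 1 ≠ 0 := by positivity
  have h3 : (l : ℝ) + 2 ≠ 0 := by positivity
  have h4 : (l : ℝ) + 1 + 1 ≠ 0 := by positivity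
  field_simp
  ring

namespace Channel

variable {k : ℕ} {𝒳 𝒴 : Type*} [Fintype 𝒳] [Fintype 𝒴]
variable {V V₁ V₂ W : Type*} [Fintype V] [DecidableEq V] [Fintype V₁] [DecidableEq V₁]
  [Fintype V₂] [DecidableEq V₂] [Fintype W] [DecidableEq W]

/-! ### Replicas and the functionals `Γ_l` -/

open Classical in
/-- The empirical distribution of the `l`-tuples `(x 0 (g w), …, x (l - 1) (g w))`, over a
uniformly random `w`. -/
def empirical {l : ℕ} (g : W → V) (x : Fin l → V → 𝒳) (c : Fin l → 𝒳) : ℝ :=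
  (Fintype.card W : ℝ)⁻¹ * ∑ w, if (fun r => x r (g w)) = c then 1 else 0

/-- The mean of `F` over the tuples of vertices of the form `g w₁, …, g w_k`. -/
def tupleMean (k : ℕ) (g : W → V) (F : (Fin k → V) → ℝ) : ℝ :=
  ((Fintype.card W : ℝ) ^ k)⁻¹ * ∑ a : Fin k → W, F (fun i => g (a i))

lemma empirical_mem_stdSimplex [Nonempty W] {l : ℕ} (g : W → V) (x : Fin l → V → 𝒳) :
    empirical g x ∈ stdSimplex ℝ (Fin l → 𝒳) := by
  classical
  refine ⟨fun c => mul_nonneg (by positivity) (Finset.sum_nonneg fun w _ => ?_), ?_⟩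
  · split_ifs <;> norm_num
  · simp only [empirical]
    rw [← Finset.mul_sum, Finset.sum_comm]
    simp

/-- The empirical distribution on a disjoint union is the mixture of the empirical distributions
on the parts. -/
lemma empirical_sum [Nonempty V₁] [Nonempty V₂] {l : ℕ} (φ : V₁ ⊕ V₂ ≃ V)
    (x : Fin l → V → 𝒳) :
    empirical (fun v => v) x =
      ((Fintype.card V₁ : ℝ) / Fintype.card V) • empirical (fun v => φ (.inl v)) x +
      ((Fintype.card V₂ : ℝ) / Fintype.card V) • empirical (fun v => φ (.inr v)) x := by
  classical
  funext c
  have h1 : (Fintype.card V₁ : ℝ) ≠ 0 := by exact_mod_cast Fintype.card_ne_zero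
  have h2 : (Fintype.card V₂ : ℝ) ≠ 0 := by exact_mod_cast Fintype.card_ne_zero
  simp only [empirical, Pi.add_apply, Pi.smul_apply, smul_eq_mul]
  rw [← Equiv.sum_comp φ, Fintype.sum_sum_type, mul_add]
  field_simp

lemma card_mul_Gamma_empirical [Nonempty 𝒴] (Q : Channel k 𝒳 𝒴) {l : ℕ} (g : W → V)
    (x : Fin l → V → 𝒳) :
    (Fintype.card 𝒴 : ℝ) * Q.Gamma l (empirical g x) =
      tupleMean k g fun t => ∑ z, ∏ r, (1 - Q.prob (fun i => x r (t i)) z) := by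
  classical
  have hY : (Fintype.card 𝒴 : ℝ) ≠ 0 := by exact_mod_cast Fintype.card_ne_zero
  have hprod : ∀ u : Fin l → Fin k → 𝒳, ∏ i, empirical g x (fun r => u r i) =
      ((Fintype.card W : ℝ) ^ k)⁻¹ *
        ∑ a : Fin k → W, if (fun r i => x r (g (a i))) = u then 1 else 0 := by
    intro u
    simp only [empirical]
    rw [Finset.prod_mul_distrib, Finset.prod_const, Finset.card_univ, Fintype.card_fin, inv_pow]
    congr 1
    rw [Finset.prod_univ_sum, Fintype.piFinset_univ]
    refine Finset.sum_congr rfl fun a _ => ?_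
    rw [Finset.prod_ite_zero]
    simp only [Finset.prod_const_one, Finset.mem_univ, true_imp_iff]
    refine if_congr ?_ rfl rfl
    constructor
    · intro h
      funext r i
      exact congrFun (h i) r
    · rintro rfl i
      rfl
  rw [Gamma, ← mul_assoc, mul_one_div_cancel hY, one_mul, tupleMean]
  simp_rw [hprod, Finset.mul_sum]
  rw [Finset.sum_comm]
  refine Finset.sum_congr rfl fun a _ => ?_
  rw [Finset.sum_eq_single (fun r i => x r (g (a i)))]
  · simp [mul_comm, Finset.mul_sum]
  · intro u _ hu
    rw [if_neg hu.symm]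
    simp
  · simp

/-- Moments of the predictive probabilities are means, over independent replicas of the input, of
the functionals `Γ_l` at the empirical distribution of the replicas. -/
lemma tupleMean_one_sub_predProb_pow [Nonempty 𝒴] (Q : Channel k 𝒳 𝒴) {R : (V → 𝒳) → ℝ}
    (hR : R ∈ stdSimplex ℝ (V → 𝒳)) (g : W → V) (l : ℕ) :
    tupleMean k g (fun t => ∑ z, (1 - Q.predProb R t z) ^ l) =
      ∑ x : Fin l → V → 𝒳, (∏ r, R (x r)) *
        ((Fintype.card 𝒴 : ℝ) * Q.Gamma l (empirical g x)) := by
  have h : ∀ t z, (1 - Q.predProb R t z) ^ l = ∑ x : Fin l → V → 𝒳, (∏ r, R (x r)) *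
      ∏ r, (1 - Q.prob (fun i => x r (t i)) z) := by
    intro t z
    have : 1 - Q.predProb R t z = ∑ x, R x * (1 - Q.prob (fun i => x (t i)) z) := by
      simp_rw [mul_sub, Finset.sum_sub_distrib, mul_one, hR.2]
      rfl
    rw [this, Fintype.sum_pow]
    simp_rw [Finset.prod_mul_distrib]
  simp_rw [card_mul_Gamma_empirical, tupleMean, h]
  rw [Finset.sum_congr rfl fun a _ => Finset.sum_comm, Finset.sum_comm, Finset.mul_sum]
  refine Finset.sum_congr rfl fun x _ => ?_
  simp_rw [← Finset.mul_sum]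
  ring

lemma HypothesisH.tupleMean_pow_le [Nonempty 𝒴] [Nonempty V₁] [Nonempty V₂]
    {Q : Channel k 𝒳 𝒴} (hQ : Q.HypothesisH) (φ : V₁ ⊕ V₂ ≃ V) {R : (V → 𝒳) → ℝ}
    (hR : R ∈ stdSimplex ℝ (V → 𝒳)) {l : ℕ} (hl : 1 ≤ l) :
    (Fintype.card V : ℝ) * tupleMean k (fun v => v) (fun t => ∑ z, (1 - Q.predProb R t z) ^ l) ≤
      (Fintype.card V₁ : ℝ) * tupleMean k (fun v => φ (.inl v))
        (fun t => ∑ z, (1 - Q.predProb R t z) ^ l) +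
      (Fintype.card V₂ : ℝ) * tupleMean k (fun v => φ (.inr v))
        (fun t => ∑ z, (1 - Q.predProb R t z) ^ l) := by
  simp_rw [Q.tupleMean_one_sub_predProb_pow hR, Finset.mul_sum, ← Finset.sum_add_distrib]
  refine Finset.sum_le_sum fun x _ => ?_
  have hV : (Fintype.card V : ℝ) = Fintype.card V₁ + Fintype.card V₂ := by
    rw [← Nat.cast_add, ← Fintype.card_sum, Fintype.card_congr φ]
  have h1 : 0 < (Fintype.card V₁ : ℝ) := by exact_mod_cast Fintype.card_pos
  have h2 : 0 < (Fintype.card V₂ : ℝ) := by exact_mod_cast Fintype.card_pos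
  have h3 : 0 < (Fintype.card V : ℝ) := by linarith
  have hconv := (hQ l hl).2 (empirical_mem_stdSimplex (fun v => φ (.inl v)) x)
    (empirical_mem_stdSimplex (fun v => φ (.inr v)) x)
    (by positivity : (0 : ℝ) ≤ (Fintype.card V₁ : ℝ) / Fintype.card V)
    (by positivity : (0 : ℝ) ≤ (Fintype.card V₂ : ℝ) / Fintype.card V)
    (by rw [← add_div, ← hV, div_self h3.ne'])
  rw [← empirical_sum φ x, smul_eq_mul, smul_eq_mul] at hconv
  have hw : 0 ≤ (Fintype.card V : ℝ) * ((∏ r, R (x r)) * Fintype.card 𝒴) :=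
    mul_nonneg h3.le (mul_nonneg (Finset.prod_nonneg fun r _ => hR.1 _) (by positivity))
  have := mul_le_mul_of_nonneg_left hconv hw
  refine (le_of_eq (by ring)).trans (this.trans_eq ?_)
  field_simp

lemma hasSum_tupleMean_predEntropy (Q : Channel k 𝒳 𝒴) [Nonempty W] {R : (V → 𝒳) → ℝ}
    (hR : R ∈ stdSimplex ℝ (V → 𝒳)) (g : W → V) :
    HasSum (fun l : ℕ => 1 / (((l : ℝ) + 1) * (l + 2)) *
        tupleMean k g (fun t => ∑ z, (1 - Q.predProb R t z) ^ (l + 2)))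
      (((Fintype.card 𝒴 : ℝ) - 1) - tupleMean k g (Q.predEntropy R)) := by
  have hle : ∀ t z, Q.predProb R t z ≤ 1 := fun t z =>
    ((Q.sum_predProb R t).trans hR.2) ▸
      Finset.single_le_sum (fun b _ => Q.predProb_nonneg hR.1 t b) (Finset.mem_univ z)
  have h := (hasSum_sum (s := (Finset.univ : Finset (Fin k → W))) fun a _ =>
    hasSum_sum (s := (Finset.univ : Finset 𝒴)) fun z _ => hasSum_one_sub_sub_negMulLog
      (Q.predProb_nonneg hR.1 (fun i => g (a i)) z) (hle _ z)).mul_left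
      ((Fintype.card W : ℝ) ^ k)⁻¹
  have hW : (Fintype.card W : ℝ) ≠ 0 := by exact_mod_cast Fintype.card_ne_zero
  have hval : ((Fintype.card W : ℝ) ^ k)⁻¹ * ∑ a : Fin k → W, ∑ z,
      ((1 - Q.predProb R (fun i => g (a i)) z) - Real.negMulLog (Q.predProb R (fun i => g (a i)) z))
      = ((Fintype.card 𝒴 : ℝ) - 1) - tupleMean k g (Q.predEntropy R) := by
    simp_rw [Finset.sum_sub_distrib, sum_predProb, hR.2, mul_sub]
    simp [tupleMean, predEntropy, hW]
  rw [hval] at h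
  refine Eq.subst (motive := fun f => HasSum f _) (funext fun l => ?_) h
  simp_rw [tupleMean, Finset.mul_sum]
  refine Finset.sum_congr rfl fun a _ => Finset.sum_congr rfl fun z _ => ?_
  ring

/-- Under Hypothesis H, the mean predictive entropy of an observation of independent uniformly
random vertices, weighted by the number of vertices, is superadditive in the set of vertices. -/
theorem HypothesisH.tupleMean_predEntropy_le [Nonempty 𝒴] [Nonempty V₁] [Nonempty V₂]
    {Q : Channel k 𝒳 𝒴} (hQ : Q.HypothesisH) (φ : V₁ ⊕ V₂ ≃ V) {R : (V → 𝒳) → ℝ}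
    (hR : R ∈ stdSimplex ℝ (V → 𝒳)) :
    (Fintype.card V₁ : ℝ) * tupleMean k (fun v => φ (.inl v)) (Q.predEntropy R) +
      (Fintype.card V₂ : ℝ) * tupleMean k (fun v => φ (.inr v)) (Q.predEntropy R) ≤
    (Fintype.card V : ℝ) * tupleMean k (fun v => v) (Q.predEntropy R) := by
  have : Nonempty V := ⟨φ (.inl (Classical.arbitrary V₁))⟩
  have hV : (Fintype.card V : ℝ) = Fintype.card V₁ + Fintype.card V₂ := by
    rw [← Nat.cast_add, ← Fintype.card_sum, Fintype.card_congr φ]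
  have h := (Q.hasSum_tupleMean_predEntropy hR (fun v : V => v)).mul_left (Fintype.card V : ℝ)
  have h1 := (Q.hasSum_tupleMean_predEntropy hR (fun v => φ (.inl v))).mul_left
    (Fintype.card V₁ : ℝ)
  have h2 := (Q.hasSum_tupleMean_predEntropy hR (fun v => φ (.inr v))).mul_left
    (Fintype.card V₂ : ℝ)
  have hle := hasSum_le (fun l => ?_) h (h1.add h2)
  · rw [hV] at hle ⊢
    linarith
  · have hl := hQ.tupleMean_pow_le φ hR (l := l + 2) (by omega)
    have hc : (0 : ℝ) ≤ 1 / (((l : ℝ) + 1) * (l + 2)) := by positivity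
    have := mul_le_mul_of_nonneg_left hl hc
    refine (le_of_eq (by ring)).trans (this.trans_eq (by ring))

end Channel

namespace Channel

variable {k : ℕ} {𝒳 𝒴 : Type*} [Fintype 𝒳] [Fintype 𝒴]
variable {V J : Type*} [Fintype V] [DecidableEq V] [Fintype J] [DecidableEq J]

lemma nonempty_output [Nonempty 𝒳] (Q : Channel k 𝒳 𝒴) : Nonempty 𝒴 := by
  by_contra h
  rw [not_nonempty_iff] at h
  simpa using Q.sum_prob fun _ => Classical.arbitrary 𝒳

/-! ### The ensemble with independent vertices -/

/-- The rate of each `k`-tuple of vertices, repetitions allowed, in the ensemble where the total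
rate is `α n` and the vertices of each edge are independent. -/
def tupleRate (k : ℕ) (α : ℝ≥0) (n : ℕ) : ℝ≥0 := α * n / (n : ℝ≥0) ^ k

/-- The mean entropy of the outputs in the ensemble where the vertices of each edge are
independent and uniformly random. Unlike for edges with distinct vertices, it is exactly
superadditive. -/
def tupleEntropy (Q : Channel k 𝒳 𝒴) (α : ℝ≥0) (n : ℕ) : ℝ :=
  Q.meanEntropy (fun t : Fin k → Fin n => t) fun _ => tupleRate k α n

lemma sum_tupleRate_mul (α : ℝ≥0) {n : ℕ} (g : Fin n → V) (F : (Fin k → V) → ℝ) :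
    ∑ a : Fin k → Fin n, (tupleRate k α n : ℝ) * F (fun i => g (a i)) =
      α * (n * tupleMean k g F) := by
  rw [← Finset.mul_sum, tupleRate, tupleMean, Fintype.card_fin]
  push_cast
  ring

lemma sum_tupleRate (α : ℝ≥0) {n : ℕ} (hn : n ≠ 0) :
    ∑ _a : Fin k → Fin n, tupleRate k α n = α * n := by
  have : (n : ℝ≥0) ≠ 0 := by exact_mod_cast hn
  simp only [Finset.sum_const, Finset.card_univ, Fintype.card_fun, Fintype.card_fin, nsmul_eq_mul,
    tupleRate]
  push_cast
  field_simp

lemma HypothesisH.tupleEntropy_add_le [Nonempty 𝒳] {Q : Channel k 𝒳 𝒴} (hQ : Q.HypothesisH)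
    (α : ℝ≥0) {m n : ℕ} (hm : m ≠ 0) (hn : n ≠ 0) :
    Q.tupleEntropy α m + Q.tupleEntropy α n ≤ Q.tupleEntropy α (m + n) := by
  have : Nonempty 𝒴 := Q.nonempty_output
  have : NeZero m := ⟨hm⟩
  have : NeZero n := ⟨hn⟩
  rw [tupleEntropy, tupleEntropy, ← Q.meanEntropy_sum finSumFinEquiv,
    ← add_zero (Q.tupleEntropy _ _)]
  refine Q.meanEntropy_le ?_ fun R hR => ?_
  · rw [Fintype.sum_sum_type]
    simp only [Sum.elim_inl, Sum.elim_inr]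
    rw [sum_tupleRate α hm, sum_tupleRate α hn, sum_tupleRate α (by omega)]
    push_cast
    ring
  · have h := hQ.tupleMean_predEntropy_le (k := k) (finSumFinEquiv (m := m) (n := n)) hR
    simp only [Fintype.card_fin] at h
    rw [Fintype.sum_sum_type]
    simp only [Sum.elim_inl, Sum.elim_inr]
    rw [sum_tupleRate_mul α (fun v : Fin m => finSumFinEquiv (.inl v)) (Q.predEntropy R),
      sum_tupleRate_mul α (fun v : Fin n => finSumFinEquiv (.inr v)) (Q.predEntropy R),
      sum_tupleRate_mul α (fun v : Fin (m + n) => v) (Q.predEntropy R), add_zero, ← mul_add]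
    exact mul_le_mul_of_nonneg_left h α.coe_nonneg

lemma HypothesisH.exists_tendsto_tupleEntropy [Nonempty 𝒳] {Q : Channel k 𝒳 𝒴}
    (hQ : Q.HypothesisH) (α : ℝ≥0) :
    ∃ L : ℝ, Tendsto (fun n : ℕ => Q.tupleEntropy α n / n) atTop (𝓝 L) := by
  -- The value at `n = 0` is replaced by `0`: it plays no role in the limit.
  have hsub : Subadditive fun n : ℕ => if n = 0 then 0 else -Q.tupleEntropy α n := by
    intro m n
    rcases eq_or_ne m 0 with rfl | hm
    · simp
    rcases eq_or_ne n 0 with rfl | hn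
    · simp
    have := hQ.tupleEntropy_add_le α hm hn
    simp only [hm, hn, if_false, Nat.add_eq_zero_iff, false_and]
    linarith
  have hbdd : BddBelow (Set.range fun n : ℕ =>
      (if n = 0 then 0 else -Q.tupleEntropy α n) / (n : ℝ)) := by
    refine ⟨-(α * Real.log (Fintype.card 𝒴)), ?_⟩
    rintro _ ⟨n, rfl⟩
    rcases eq_or_ne n 0 with rfl | hn
    · simpa using mul_nonneg α.coe_nonneg (Real.log_natCast_nonneg _)
    · have h := Q.meanEntropy_le_log_mul (fun t : Fin k → Fin n => t) fun _ => tupleRate k α n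
      rw [← NNReal.coe_sum, sum_tupleRate α hn] at h
      have hn' : (0 : ℝ) < n := by exact_mod_cast Nat.pos_of_ne_zero hn
      simp only [hn, if_false]
      rw [le_div_iff₀ hn', tupleEntropy]
      push_cast at h
      linarith
  refine ⟨-hsub.lim, (hsub.tendsto_lim hbdd).neg.congr' ?_⟩
  filter_upwards [eventually_ne_atTop 0] with n hn
  simp only [hn, if_false]
  ring

/-! ### Edges with distinct vertices -/

/-- The mean entropy of the outputs in the ensemble of edges with distinct, randomly ordered
vertices. -/
def edgeEntropy (Q : Channel k 𝒳 𝒴) (α : ℝ≥0) (n : ℕ) : ℝ :=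
  Q.meanEntropy (fun f : Fin k ↪ Fin n => (f : Fin k → Fin n))
    fun _ => edgeRate k α n / (k.factorial : ℝ≥0)

lemma edgeRate_div_factorial (k : ℕ) (α : ℝ≥0) (n : ℕ) :
    edgeRate k α n / (k.factorial : ℝ≥0) = α * n / (n.descFactorial k : ℝ≥0) := by
  rw [edgeRate, div_div, Nat.descFactorial_eq_factorial_mul_choose, mul_comm (n.choose k : ℝ≥0)]
  push_cast
  rfl

lemma sum_edgeRate_div_factorial (α : ℝ≥0) {n : ℕ} (hn : k ≤ n) :
    ∑ _f : Fin k ↪ Fin n, edgeRate k α n / (k.factorial : ℝ≥0) = α * n := by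
  have : (n.descFactorial k : ℝ≥0) ≠ 0 := by
    exact_mod_cast (Nat.descFactorial_pos.mpr hn).ne'
  rw [Finset.sum_const, Finset.card_univ, Fintype.card_embedding_eq, edgeRate_div_factorial]
  simp only [Fintype.card_fin, nsmul_eq_mul]
  field_simp

lemma sum_edgeRate (α : ℝ≥0) {n : ℕ} (hn : k ≤ n) :
    ∑ _I : Hyperedge k n, edgeRate k α n = α * n := by
  have : (n.choose k : ℝ≥0) ≠ 0 := by exact_mod_cast (Nat.choose_pos hn).ne'
  rw [Finset.sum_const, Finset.card_univ, Fintype.card_finset_len, edgeRate]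
  simp only [Fintype.card_fin, nsmul_eq_mul]
  field_simp

lemma sum_embedding_le_sum {n : ℕ} {F : (Fin k → Fin n) → ℝ} (hF : ∀ t, 0 ≤ F t) :
    ∑ f : Fin k ↪ Fin n, F f ≤ ∑ t, F t := by
  have h := Finset.sum_map Finset.univ
    (⟨fun f => f, DFunLike.coe_injective⟩ : (Fin k ↪ Fin n) ↪ (Fin k → Fin n)) F
  rw [← show _ = ∑ f : Fin k ↪ Fin n, F f from h]
  exact Finset.sum_le_sum_of_subset_of_nonneg (Finset.subset_univ _) fun t _ _ => hF t

/-- Only a fraction `1 - (n)_k / n ^ k` of all tuples have a repeated vertex, and each of them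
contributes at most `log |𝒴|` to the entropy. -/
lemma abs_edgeEntropy_sub_tupleEntropy_le [Nonempty 𝒳] (Q : Channel k 𝒳 𝒴) (α : ℝ≥0) {n : ℕ}
    (hk : k ≤ n) (hn : n ≠ 0) :
    |Q.edgeEntropy α n - Q.tupleEntropy α n| ≤
      α * n * (1 - (n.descFactorial k : ℝ) / (n : ℝ) ^ k) * Real.log (Fintype.card 𝒴) := by
  set D := (n.descFactorial k : ℝ) with hD
  have hD0 : 0 < D := by rw [hD]; exact_mod_cast Nat.descFactorial_pos.mpr hk
  have hn0 : (0 : ℝ) < n := by exact_mod_cast Nat.pos_of_ne_zero hn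
  have hDn : D ≤ (n : ℝ) ^ k := by rw [hD]; exact_mod_cast Nat.descFactorial_le_pow n k
  set L := Real.log (Fintype.card 𝒴)
  have hα := α.coe_nonneg
  have hr : ((edgeRate k α n / (k.factorial : ℝ≥0) : ℝ≥0) : ℝ) = α * n / D := by
    rw [edgeRate_div_factorial]; push_cast; rfl
  have hr' : (tupleRate k α n : ℝ) = α * n / (n : ℝ) ^ k := by rw [tupleRate]; push_cast; rfl
  have hsum : ∑ _f : Fin k ↪ Fin n, edgeRate k α n / (k.factorial : ℝ≥0) =
      ∑ _t : Fin k → Fin n, tupleRate k α n := by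
    rw [sum_edgeRate_div_factorial α hk, sum_tupleRate α hn]
  have hle : ∀ R ∈ stdSimplex ℝ (Fin n → 𝒳), ∑ f : Fin k ↪ Fin n, Q.predEntropy R f ≤
      ∑ t, Q.predEntropy R t :=
    fun R hR => sum_embedding_le_sum fun t => Q.predEntropy_nonneg hR t
  rw [abs_sub_le_iff, sub_le_iff_le_add', sub_le_iff_le_add']
  constructor
  · refine Q.meanEntropy_le hsum fun R hR => ?_
    simp_rw [hr, hr', ← Finset.mul_sum]
    have h1 := hle R hR
    have h2 : ∑ f : Fin k ↪ Fin n, Q.predEntropy R f ≤ D * L := by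
      refine (Finset.sum_le_sum (f := fun f : Fin k ↪ Fin n => Q.predEntropy R f)
        (g := fun _ => L) fun f _ => Q.predEntropy_le hR f).trans_eq ?_
      rw [Finset.sum_const, Finset.card_univ, Fintype.card_embedding_eq]
      simp [hD]
    have h3 : 0 ≤ α * n / D - α * n / (n : ℝ) ^ k := by
      rw [sub_nonneg]
      gcongr
    have h4 := mul_le_mul_of_nonneg_left h2 h3
    have h5 := mul_le_mul_of_nonneg_left h1 (by positivity : 0 ≤ (α : ℝ) * n / (n : ℝ) ^ k)
    have h6 : (α * n / D - α * n / (n : ℝ) ^ k) * (D * L) =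
        α * n * (1 - D / (n : ℝ) ^ k) * L := by
      field_simp
    linarith
  · refine Q.meanEntropy_le hsum.symm fun R hR => ?_
    simp_rw [hr, hr', ← Finset.mul_sum]
    have h1 : ∑ f : Fin k ↪ Fin n, (L - Q.predEntropy R f) ≤ ∑ t, (L - Q.predEntropy R t) :=
      sum_embedding_le_sum fun t => sub_nonneg.mpr (Q.predEntropy_le hR t)
    rw [Finset.sum_sub_distrib, Finset.sum_sub_distrib, Finset.sum_const, Finset.sum_const,
      Finset.card_univ, Finset.card_univ, Fintype.card_embedding_eq] at h1
    simp only [Fintype.card_fin, Fintype.card_fun, nsmul_eq_mul, Nat.cast_pow, ← hD] at h1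
    have h2 : 0 ≤ ∑ f : Fin k ↪ Fin n, Q.predEntropy R f :=
      Finset.sum_nonneg fun f _ => Q.predEntropy_nonneg hR f
    have h3 : 0 ≤ α * n / D - α * n / (n : ℝ) ^ k := by
      rw [sub_nonneg]
      gcongr
    have h4 := mul_nonneg h3 h2
    have h5 := mul_le_mul_of_nonneg_left h1 (by positivity : 0 ≤ (α : ℝ) * n / (n : ℝ) ^ k)
    have h6 : α * n / (n : ℝ) ^ k * ((n : ℝ) ^ k * L - D * L) =
        α * n * (1 - D / (n : ℝ) ^ k) * L := by
      field_simp
    rw [mul_sub, mul_sub] at h5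
    rw [mul_sub] at h6
    linarith

lemma tendsto_descFactorial_div_pow (k : ℕ) :
    Tendsto (fun n : ℕ => (n.descFactorial k : ℝ) / (n : ℝ) ^ k) atTop (𝓝 1) := by
  refine (Asymptotics.isEquivalent_iff_tendsto_one ?_).mp (isEquivalent_descFactorial k)
  filter_upwards [eventually_ne_atTop 0] with n hn
  positivity

lemma HypothesisH.exists_tendsto_edgeEntropy [Nonempty 𝒳] {Q : Channel k 𝒳 𝒴}
    (hQ : Q.HypothesisH) (α : ℝ≥0) :
    ∃ L : ℝ, Tendsto (fun n : ℕ => Q.edgeEntropy α n / n) atTop (𝓝 L) := by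
  obtain ⟨L, hL⟩ := hQ.exists_tendsto_tupleEntropy α
  refine ⟨L, ?_⟩
  have hb : Tendsto (fun n : ℕ => α * (1 - (n.descFactorial k : ℝ) / (n : ℝ) ^ k) *
      Real.log (Fintype.card 𝒴)) atTop (𝓝 0) := by
    have := (((tendsto_descFactorial_div_pow k).const_sub 1).const_mul (α : ℝ)).mul_const
      (Real.log (Fintype.card 𝒴))
    simpa using this
  have hd : Tendsto (fun n : ℕ => (Q.edgeEntropy α n - Q.tupleEntropy α n) / n) atTop (𝓝 0) := by
    refine squeeze_zero_norm' ?_ hb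
    filter_upwards [eventually_ge_atTop k, eventually_ne_atTop 0] with n hk hn
    have hn0 : (0 : ℝ) < n := by exact_mod_cast Nat.pos_of_ne_zero hn
    rw [Real.norm_eq_abs, abs_div, abs_of_pos hn0, div_le_iff₀ hn0]
    refine (Q.abs_edgeEntropy_sub_tupleEntropy_le α hk hn).trans_eq (by ring)
  have := hL.add hd
  rw [add_zero] at this
  refine this.congr fun n => ?_
  rw [sub_div, add_sub_cancel]

lemma injective_of_range_hyperedge {n : ℕ} {τ : Hyperedge k n → Fin k → Fin n}
    (hτ : ∀ I, Set.range (τ I) = (I.1 : Set (Fin n))) (I : Hyperedge k n) : (τ I).Injective := by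
  classical
  have h : Finset.univ.image (τ I) = I.1 := by
    rw [← Finset.coe_inj, Finset.coe_image, Finset.coe_univ, Set.image_univ, hτ]
  have hc : (Finset.univ.image (τ I)).card = (Finset.univ : Finset (Fin k)).card := by
    rw [h, I.2, Finset.card_univ, Fintype.card_fin]
  exact fun i j hij => Finset.card_image_iff.mp hc (Finset.mem_coe.mpr (Finset.mem_univ i))
    (Finset.mem_coe.mpr (Finset.mem_univ j)) hij

/-- Every injective `k`-tuple of vertices arises from exactly one pair of a hyperedge and a
permutation of the listing of its vertices. -/
lemma sum_embedding_eq_sum_hyperedge {n : ℕ} {τ : Hyperedge k n → Fin k → Fin n}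
    (hτ : ∀ I, Set.range (τ I) = (I.1 : Set (Fin n))) (F : (Fin k → Fin n) → ℝ) :
    ∑ f : Fin k ↪ Fin n, F f = ∑ I, ∑ σ : Equiv.Perm (Fin k), F (τ I ∘ σ) := by
  have hinj := injective_of_range_hyperedge hτ
  let g : Hyperedge k n × Equiv.Perm (Fin k) → (Fin k ↪ Fin n) :=
    fun p => ⟨τ p.1 ∘ p.2, (hinj p.1).comp p.2.injective⟩
  have hg : Function.Bijective g := by
    rw [Fintype.bijective_iff_injective_and_card]
    refine ⟨?_, ?_⟩
    · rintro ⟨I, σ⟩ ⟨I', σ'⟩ h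
      have h' : τ I ∘ σ = τ I' ∘ σ' := congrArg (fun f : Fin k ↪ Fin n => (f : Fin k → Fin n)) h
      have hI : I = I' := by
        have := congrArg Set.range h'
        rw [EquivLike.range_comp, EquivLike.range_comp, hτ, hτ] at this
        exact Subtype.ext (Finset.coe_injective this)
      subst hI
      have hσ : σ = σ' := Equiv.ext fun i => hinj I (congrFun h' i)
      rw [hσ]
    · rw [Fintype.card_prod, Fintype.card_finset_len, Fintype.card_perm, Fintype.card_embedding_eq,
        Fintype.card_fin, Fintype.card_fin, Nat.descFactorial_eq_factorial_mul_choose, mul_comm]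
  rw [← Fintype.sum_prod_type', ← (Equiv.ofBijective g hg).sum_comp]
  rfl

lemma OrderInsensitive.meanEntropy_listing_eq [Nonempty 𝒳] {Q : Channel k 𝒳 𝒴}
    (hQ : Q.OrderInsensitive) (α : ℝ≥0) {n : ℕ} (hn : k ≤ n) {τ : Hyperedge k n → Fin k → Fin n}
    (hτ : ∀ I, Set.range (τ I) = (I.1 : Set (Fin n))) :
    Q.meanEntropy τ (fun _ => edgeRate k α n) = Q.edgeEntropy α n := by
  have hsum : ∑ _I : Hyperedge k n, edgeRate k α n =
      ∑ _f : Fin k ↪ Fin n, edgeRate k α n / (k.factorial : ℝ≥0) := by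
    rw [sum_edgeRate α hn, sum_edgeRate_div_factorial α hn]
  have hpred : ∀ R ∈ stdSimplex ℝ (Fin n → 𝒳),
      ∑ I, (edgeRate k α n : ℝ) * Q.predEntropy R (τ I) = ∑ f : Fin k ↪ Fin n,
        ((edgeRate k α n / (k.factorial : ℝ≥0) : ℝ≥0) : ℝ) * Q.predEntropy R f := by
    intro R _
    rw [← Finset.mul_sum, ← Finset.mul_sum, sum_embedding_eq_sum_hyperedge hτ]
    simp_rw [hQ.predEntropy_comp]
    simp only [Finset.sum_const, Finset.card_univ, Fintype.card_perm, Fintype.card_fin,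
      nsmul_eq_mul, ← Finset.mul_sum]
    push_cast
    have : (k.factorial : ℝ) ≠ 0 := by positivity
    field_simp
  refine le_antisymm ?_ ?_
  · rw [← add_zero (Q.edgeEntropy α n)]
    exact Q.meanEntropy_le hsum fun R hR => by rw [add_zero, hpred R hR]
  · rw [← add_zero (Q.meanEntropy _ _)]
    exact Q.meanEntropy_le hsum.symm fun R hR => by rw [add_zero, hpred R hR]

/-! ### From the output entropy to the conditional entropy of the input -/

/-- The entropy, in nats, of the output of the kernel given its uniformly random input. -/
def noiseEntropy (Q : Channel k 𝒳 𝒴) : ℝ :=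
  ((Fintype.card 𝒳 : ℝ) ^ k)⁻¹ * ∑ u, ∑ z, Real.negMulLog (Q.prob u z)

/-- Distinct vertices of a uniformly random `x` carry independent uniformly random letters. -/
lemma sum_comp_injective [Nonempty 𝒳] {t : Fin k → V} (ht : t.Injective)
    (F : (Fin k → 𝒳) → ℝ) :
    ((Fintype.card 𝒳 : ℝ) ^ Fintype.card V)⁻¹ * ∑ x : V → 𝒳, F (fun i => x (t i)) =
      ((Fintype.card 𝒳 : ℝ) ^ k)⁻¹ * ∑ u, F u := by
  classical
  let φ : Fin k ⊕ ((Set.range t)ᶜ : Set V) ≃ V :=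
    (Equiv.sumCongr (Equiv.ofInjective t ht) (Equiv.refl _)).trans (Equiv.Set.sumCompl _)
  have hφ : ∀ i, φ (.inl i) = t i := fun i => by simp [φ]
  have hcard : Fintype.card V = k + Fintype.card ((Set.range t)ᶜ : Set V) := by
    rw [← Fintype.card_congr φ, Fintype.card_sum, Fintype.card_fin]
  have hX : (Fintype.card 𝒳 : ℝ) ≠ 0 := by exact_mod_cast Fintype.card_ne_zero
  rw [← Equiv.sum_comp
    ((Equiv.sumArrowEquivProdArrow (Fin k) ((Set.range t)ᶜ : Set V) 𝒳).symm.trans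
    (Equiv.arrowCongr φ (Equiv.refl 𝒳))), Fintype.sum_prod_type]
  have h : ∀ (u : Fin k → 𝒳) (v : ((Set.range t)ᶜ : Set V) → 𝒳),
      F (fun i => ((Equiv.sumArrowEquivProdArrow (Fin k) ((Set.range t)ᶜ : Set V) 𝒳).symm.trans
        (Equiv.arrowCongr φ (Equiv.refl 𝒳))) (u, v) (t i)) = F u := by
    intro u v
    congr 1
    funext i
    simp [Equiv.arrowCongr, Equiv.sumArrowEquivProdArrow, ← hφ]
  simp_rw [h]
  rw [hcard]
  simp only [Finset.sum_const, Finset.card_univ, Fintype.card_fun, nsmul_eq_mul, ← Finset.mul_sum]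
  push_cast
  rw [pow_add]
  field_simp

/-- `H(X | Y) = H(X) + H(Y | X) - H(Y)`, in nats. -/
lemma sum_jointProb_mul_log_posterior [Nonempty 𝒳] (Q : Channel k 𝒳 𝒴) {ε : J → Fin k → V}
    (hε : ∀ j, (ε j).Injective) :
    ∑ x, ∑ y, -(Q.jointProb ε x y * Real.log (Q.jointProb ε x y / Q.outProb ε y)) =
      Fintype.card V * Real.log (Fintype.card 𝒳) + Fintype.card J * Q.noiseEntropy -
        Q.outEntropy ε := by
  have hX : (Fintype.card 𝒳 : ℝ) ≠ 0 := by exact_mod_cast Fintype.card_ne_zero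
  have hpt : ∀ x y, -(Q.jointProb ε x y * Real.log (Q.jointProb ε x y / Q.outProb ε y)) =
      Real.negMulLog (Q.jointProb ε x y) + Q.jointProb ε x y * Real.log (Q.outProb ε y) := by
    intro x y
    rcases eq_or_ne (Q.jointProb ε x y) 0 with h0 | h0
    · simp [h0]
    · have hpos : 0 < Q.jointProb ε x y := lt_of_le_of_ne (Q.jointProb_nonneg ε x y) h0.symm
      have hS : Q.jointProb ε x y ≤ Q.outProb ε y :=
        Finset.single_le_sum (fun x _ => Q.jointProb_nonneg ε x y) (Finset.mem_univ x)
      rw [Real.log_div h0 (hpos.trans_le hS).ne', Real.negMulLog]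
      ring
  have hout : ∑ x, ∑ y, Q.jointProb ε x y * Real.log (Q.outProb ε y) = -Q.outEntropy ε := by
    rw [Finset.sum_comm]
    simp_rw [← Finset.sum_mul]
    rw [outEntropy, ← Finset.sum_neg_distrib]
    refine Finset.sum_congr rfl fun y _ => ?_
    rw [Real.negMulLog, neg_mul, neg_neg]
    rfl
  have hjoint : ∀ x, ∑ y, Real.negMulLog (Q.jointProb ε x y) =
      ((Fintype.card 𝒳 : ℝ) ^ Fintype.card V)⁻¹ *
        ∑ j, ∑ z, Real.negMulLog (Q.prob (fun i => x (ε j i)) z) +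
      Real.negMulLog ((Fintype.card 𝒳 : ℝ) ^ Fintype.card V)⁻¹ := by
    intro x
    simp_rw [jointProb, Real.negMulLog_mul]
    rw [Finset.sum_add_distrib, ← Finset.mul_sum, ← Finset.sum_mul, sum_prod_prob, one_mul,
      sum_negMulLog_prod fun j => Q.sum_prob _]
  simp_rw [hpt, Finset.sum_add_distrib]
  rw [hout]
  simp_rw [hjoint]
  rw [Finset.sum_add_distrib, ← Finset.mul_sum, Finset.sum_comm, Finset.mul_sum]
  have hnoise : ∀ j, ((Fintype.card 𝒳 : ℝ) ^ Fintype.card V)⁻¹ *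
      ∑ x : V → 𝒳, ∑ z, Real.negMulLog (Q.prob (fun i => x (ε j i)) z) = Q.noiseEntropy :=
    fun j => sum_comp_injective (hε j) fun u => ∑ z, Real.negMulLog (Q.prob u z)
  simp_rw [hnoise]
  simp only [Finset.sum_const, Finset.card_univ, Fintype.card_fun, nsmul_eq_mul, Real.negMulLog,
    Real.log_inv, Real.log_pow]
  push_cast
  field_simp
  ring

lemma log_two_mul_condEntropy [Nonempty 𝒳] {E : Type*} [Fintype E] [DecidableEq E]
    (Q : Channel k 𝒳 𝒴) {n : ℕ} {e : E → Fin k → Fin n} (he : ∀ a, (e a).Injective)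
    (m : E → ℕ) :
    Real.log 2 * Q.condEntropy e m =
      n * Real.log (Fintype.card 𝒳) + (∑ a, (m a : ℝ)) * Q.noiseEntropy -
        Q.outEntropy (fun j : Σ a, Fin (m a) => e j.1) := by
  have h := Q.sum_jointProb_mul_log_posterior (ε := fun j : Σ a, Fin (m a) => e j.1)
    fun j => he j.1
  have hJ : (Fintype.card (Σ a, Fin (m a)) : ℝ) = ∑ a, (m a : ℝ) := by simp
  rw [hJ, Fintype.card_fin] at h
  have hlog : ∀ x y, Real.log 2 * (Q.likelihood e m x y * Real.logb 2 (Q.posterior e m x y)) *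
      ((Fintype.card 𝒳 : ℝ) ^ n)⁻¹ =
      (Q.likelihood e m x y * ((Fintype.card 𝒳 : ℝ) ^ n)⁻¹) *
        Real.log ((Q.likelihood e m x y * ((Fintype.card 𝒳 : ℝ) ^ n)⁻¹) / Q.outputProb e m y) := by
    intro x y
    rw [posterior, Real.logb, one_div_mul_eq_div]
    have : Real.log 2 ≠ 0 := (Real.log_pos one_lt_two).ne'
    field_simp
  have hlik : ∀ x y, Q.likelihood e m x (fun a i => y ⟨a, i⟩) * ((Fintype.card 𝒳 : ℝ) ^ n)⁻¹ =
      Q.jointProb (fun j : Σ a, Fin (m a) => e j.1) x y := by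
    intro x y
    rw [jointProb, likelihood, Fintype.prod_sigma, Fintype.card_fin]
  have hout : ∀ y, Q.outputProb e m (fun a i => y ⟨a, i⟩) =
      Q.outProb (fun j : Σ a, Fin (m a) => e j.1) y :=
    fun y => Finset.sum_congr rfl fun x _ => hlik x y
  rw [← h, condEntropy, mul_neg, ← mul_assoc, mul_comm (Real.log 2), mul_assoc]
  simp_rw [Finset.mul_sum]
  simp_rw [Finset.sum_neg_distrib]
  congr 1
  refine Finset.sum_congr rfl fun x _ => ?_
  rw [← (Equiv.piCurry fun a (_ : Fin (m a)) => 𝒴).sum_comp]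
  refine Finset.sum_congr rfl fun y _ => ?_
  rw [← hlik, ← hout, ← hlog, mul_comm]
  rfl

lemma meanCondEntropy_eq [Nonempty 𝒳] {E : Type*} [Fintype E] [DecidableEq E]
    (Q : Channel k 𝒳 𝒴) {n : ℕ} {e : E → Fin k → Fin n} (he : ∀ a, (e a).Injective) (p : ℝ≥0) :
    Q.meanCondEntropy e p = (Real.log 2)⁻¹ *
      (n * Real.log (Fintype.card 𝒳) + ((∑ _a : E, p : ℝ≥0) : ℝ) * Q.noiseEntropy -
        Q.meanEntropy e fun _ => p) := by
  have h2 : Real.log 2 ≠ 0 := (Real.log_pos one_lt_two).ne'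
  have h : ∀ m, Q.condEntropy e m = (Real.log 2)⁻¹ * (n * Real.log (Fintype.card 𝒳) +
      (∑ a, (m a : ℝ)) * Q.noiseEntropy - Q.outEntropy (fun j : Σ a, Fin (m a) => e j.1)) :=
    fun m => by rw [← Q.log_two_mul_condEntropy he, inv_mul_cancel_left₀ h2]
  have hi : ∀ a ∈ Finset.univ, Integrable (fun m : E → ℕ => (m a : ℝ))
      (Measure.pi fun _ => poissonMeasure p) := fun a _ =>
    integrable_eval_pi_poisson (fun _ => p) a
  have hi' := (integrable_finsetSum _ hi).mul_const Q.noiseEntropy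
  have ho := Q.integrable_outEntropy e fun _ => p
  have hc : Integrable (fun m : E → ℕ => n * Real.log (Fintype.card 𝒳) +
      (∑ a, (m a : ℝ)) * Q.noiseEntropy) (Measure.pi fun _ => poissonMeasure p) :=
    (integrable_const _).add hi'
  simp only [meanCondEntropy, h]
  rw [integral_const_mul, integral_sub hc ho,
    integral_add (integrable_const _) hi', integral_mul_const Q.noiseEntropy, integral_finsetSum _ hi]
  have hp : ∀ a, ∫ m : E → ℕ, (m a : ℝ) ∂(Measure.pi fun _ => poissonMeasure p) = p :=
    integral_eval_pi_poisson fun _ => p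
  simp_rw [hp]
  simp [meanEntropy]

end Channel

end

theorem corollary1 {𝒳 𝒴 : Type*} [Fintype 𝒳] [Nonempty 𝒳] [Fintype 𝒴]
    (k : ℕ) (hk : 1 ≤ k) (α : ℝ≥0) (hα : 0 < α) (Q : Channel k 𝒳 𝒴) (hQ : Q.HypothesisH) :
    ∃ C : ℝ,
      Tendsto (fun n : ℕ => Q.entropy α n / (n : ℝ)) atTop (𝓝 C) ∧
      (Q.OrderInsensitive →
        ∀ τ : (n : ℕ) → Channel.Hyperedge k n → Fin k → Fin n,
          (∀ n I, Set.range (τ n I) = (I.1 : Set (Fin n))) →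
          Tendsto (fun n : ℕ => Q.entropyOfListing α n (τ n) / (n : ℝ)) atTop (𝓝 C)) := by
  obtain ⟨L, hL⟩ := hQ.exists_tendsto_edgeEntropy α
  have hentropy : ∀ n, k ≤ n → Q.entropy α n = (Real.log 2)⁻¹ *
      (n * Real.log (Fintype.card 𝒳) + α * n * Q.noiseEntropy - Q.edgeEntropy α n) := by
    intro n hn
    rw [Channel.entropy, Q.meanCondEntropy_eq (fun f => f.injective),
      Channel.sum_edgeRate_div_factorial α hn]
    push_cast
    rfl
  have hlim : Tendsto (fun n : ℕ => Q.entropy α n / (n : ℝ)) atTop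
      (𝓝 ((Real.log 2)⁻¹ * (Real.log (Fintype.card 𝒳) + α * Q.noiseEntropy - L))) := by
    refine ((hL.const_sub (Real.log (Fintype.card 𝒳) + α * Q.noiseEntropy)).const_mul
      (Real.log 2)⁻¹).congr' ?_
    filter_upwards [eventually_ge_atTop k, eventually_ne_atTop 0] with n hkn hn
    have hn0 : (n : ℝ) ≠ 0 := by exact_mod_cast hn
    rw [hentropy n hkn]
    field_simp
  refine ⟨_, hlim, fun hO τ hτ => hlim.congr' ?_⟩
  filter_upwards [eventually_ge_atTop k] with n hkn
  rw [hentropy n hkn, Channel.entropyOfListing,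
    Q.meanCondEntropy_eq (Channel.injective_of_range_hyperedge (hτ n)),
    Channel.sum_edgeRate α hkn, hO.meanEntropy_listing_eq α hkn (hτ n)]
  push_cast
  rfl
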